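/- Let $n$ be a positive integer and let $\mathbb C\{x_1,\dots,x_n\}$ be the $\mathbb C$-algebra of power series that converge absolutely in a neighbourhood of the origin. Let $f \in \mathbb C\{x_1,\dots,x_n\}$ define an isolated singularity at the origin, i.e. $f(0)=0$ and, in some neighbourhood of the origin, there is no point other than the origin at which $f$ and all its partial derivatives vanish. Let $\mu = \dim_{\mathbb C} \mathbb C\{x_1,\dots,x_n\}/(\partial f/\partial x_1,\dots,\partial f/\partial x_n)$ be its (finite) Milnor number. Then for every integer $N \ge \mu+1$ there exists a $\mathbb C$-algebra automorphism $\Psi$ of $\mathbb C\{x_1,\dots,x_n\}$ such that (1) $\Psi(f)$ is equal to the truncation of $f$ up to degree $N$, and (2) for every $i \in \{1,\dots,n\}$ the truncation of $\Psi(x_i)$ up to degree $N-\mu$ is equal to $x_i$. Here the truncation of a power series up to degree $d$ is the sum of its terms of total degree at most $d$. -/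

import Mathlib

open scoped Topology

noncomputable section

namespace ConvSeries

/-- A formal power series in `n` variables over `ℂ` converges absolutely on some neighbourhood of
the origin iff it converges absolutely at some point `(r, …, r)` with `r > 0`. -/
def IsConvergent {n : ℕ} (f : MvPowerSeries (Fin n) ℂ) : Prop :=
  ∃ r : ℝ, 0 < r ∧ Summable fun d : Fin n →₀ ℕ => ‖MvPowerSeries.coeff d f‖ * r ^ d.degree

theorem summable_of_le {n : ℕ} {f : MvPowerSeries (Fin n) ℂ} {r s : ℝ} (hr : 0 ≤ r) (hrs : r ≤ s)
    (hs : Summable fun d : Fin n →₀ ℕ => ‖MvPowerSeries.coeff d f‖ * s ^ d.degree) :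
    Summable fun d : Fin n →₀ ℕ => ‖MvPowerSeries.coeff d f‖ * r ^ d.degree :=
  Summable.of_nonneg_of_le (fun d => by positivity) (fun d => by gcongr) hs

theorem isConvergent_add {n : ℕ} {f g : MvPowerSeries (Fin n) ℂ}
    (hf : IsConvergent f) (hg : IsConvergent g) : IsConvergent (f + g) := by
  obtain ⟨r, hr, hf⟩ := hf
  obtain ⟨s, hs, hg⟩ := hg
  have hm : 0 < min r s := lt_min hr hs
  refine ⟨min r s, hm, Summable.of_nonneg_of_le (fun d => by positivity) (fun d => ?_)
    ((summable_of_le hm.le (min_le_left r s) hf).add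
      (summable_of_le hm.le (min_le_right r s) hg))⟩
  rw [map_add, ← add_mul]
  gcongr
  exact norm_add_le _ _

theorem summable_antidiagonal {n : ℕ} {F G : (Fin n →₀ ℕ) → ℝ} (hF : Summable F)
    (hG : Summable G) (hF0 : 0 ≤ F) (hG0 : 0 ≤ G) :
    Summable fun d => ∑ p ∈ Finset.HasAntidiagonal.antidiagonal d, F p.1 * G p.2 :=
  summable_sum_mul_antidiagonal_of_summable_mul (hF.mul_of_nonneg hG hF0 hG0)

theorem isConvergent_mul {n : ℕ} {f g : MvPowerSeries (Fin n) ℂ}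
    (hf : IsConvergent f) (hg : IsConvergent g) : IsConvergent (f * g) := by
  obtain ⟨r, hr, hf⟩ := hf
  obtain ⟨s, hs, hg⟩ := hg
  obtain ⟨t, ht, htr, hts⟩ : ∃ t : ℝ, 0 < t ∧ t ≤ r ∧ t ≤ s :=
    ⟨min r s, lt_min hr hs, min_le_left r s, min_le_right r s⟩
  have h := summable_antidiagonal (summable_of_le ht.le htr hf) (summable_of_le ht.le hts hg)
    (fun d => mul_nonneg (norm_nonneg _) (pow_nonneg ht.le _))
    (fun d => mul_nonneg (norm_nonneg _) (pow_nonneg ht.le _))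
  refine ⟨t, ht, Summable.of_nonneg_of_le
    (fun d => mul_nonneg (norm_nonneg _) (pow_nonneg ht.le _)) (fun d => ?_) h⟩
  rw [MvPowerSeries.coeff_mul]
  refine (mul_le_mul_of_nonneg_right (norm_sum_le _ _) (pow_nonneg ht.le _)).trans_eq ?_
  rw [Finset.sum_mul]
  refine Finset.sum_congr rfl fun p hp => ?_
  rw [← Finset.HasAntidiagonal.mem_antidiagonal.mp hp, map_add, pow_add, norm_mul]
  ring

theorem isConvergent_monomial {n : ℕ} (d : Fin n →₀ ℕ) (a : ℂ) :
    IsConvergent (MvPowerSeries.monomial d a) := by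
  classical
  refine ⟨1, one_pos, summable_of_ne_finset_zero (s := {d}) fun e he => ?_⟩
  rw [MvPowerSeries.coeff_monomial, if_neg (by simpa using he)]
  simp

theorem isConvergent_pderiv {n : ℕ} (i : Fin n) {f : MvPowerSeries (Fin n) ℂ}
    (hf : IsConvergent f) : IsConvergent (MvPowerSeries.pderiv ℂ i f) := by
  obtain ⟨r, hr, hf⟩ := hf
  have h := (hf.comp_injective (add_left_injective (Finsupp.single i 1))).mul_left r⁻¹
  refine ⟨r / 2, by positivity, Summable.of_nonneg_of_le (fun d => by positivity)
    (fun d => ?_) h⟩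
  have h1 : ((d i : ℝ) + 1) ≤ 2 ^ d.degree := by
    have : d i + 1 ≤ 2 ^ d.degree :=
      (Nat.succ_le_of_lt (d i).lt_two_pow_self).trans
        (Nat.pow_le_pow_right (by norm_num) (Finsupp.le_degree i d))
    exact_mod_cast this
  have h2 : ‖((d i : ℂ) + 1)‖ = (d i : ℝ) + 1 := by
    exact_mod_cast Complex.norm_natCast (d i + 1)
  simp only [Function.comp_apply]
  rw [MvPowerSeries.coeff_pderiv, norm_mul, h2, map_add, Finsupp.degree_single, pow_succ, div_pow]
  calc _ ≤ ‖MvPowerSeries.coeff (d + Finsupp.single i 1) f‖ * 2 ^ d.degree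
        * (r ^ d.degree / 2 ^ d.degree) := by gcongr
    _ = _ := by field_simp

end ConvSeries

open ConvSeries

/-- The `ℂ`-algebra `ℂ{x₁, …, xₙ}` of convergent power series. -/
def ConvSeries (n : ℕ) : Subalgebra ℂ (MvPowerSeries (Fin n) ℂ) where
  carrier := {f | IsConvergent f}
  mul_mem' := isConvergent_mul
  add_mem' := isConvergent_add
  algebraMap_mem' a := isConvergent_monomial 0 a

namespace ConvSeries

variable {n : ℕ}

/-- The coordinate `xᵢ` as a convergent power series. -/
def X (i : Fin n) : ConvSeries n :=
  ⟨MvPowerSeries.X i, isConvergent_monomial _ _⟩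

/-- The partial derivative `∂f/∂xᵢ`. -/
def pderiv (i : Fin n) (f : ConvSeries n) : ConvSeries n :=
  ⟨MvPowerSeries.pderiv ℂ i f.1, isConvergent_pderiv i f.2⟩

/-- The value of `f` at `z`, meaningful for `z` in the domain of absolute convergence, hence for
all `z` close to the origin. -/
def eval (f : ConvSeries n) (z : Fin n → ℂ) : ℂ :=
  ∑' d : Fin n →₀ ℕ, MvPowerSeries.coeff d f.1 * d.prod fun i k => z i ^ k

/-- `f` defines an isolated singularity at the origin: the origin lies on `{f = 0}`, and in some
neighbourhood of the origin the hypersurface `{f = 0}` has no singular point (a point where `f`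
and all its partial derivatives vanish) other than possibly the origin. -/
def IsIsolatedSingularity (f : ConvSeries n) : Prop :=
  eval f 0 = 0 ∧ ∀ᶠ z in 𝓝[≠] (0 : Fin n → ℂ), ¬ (eval f z = 0 ∧ ∀ i, eval (pderiv i f) z = 0)

/-- The Jacobian ideal `j(f)`, generated by the partial derivatives of `f`. -/
def jacobianIdeal (f : ConvSeries n) : Ideal (ConvSeries n) :=
  Ideal.span (Set.range fun i => pderiv i f)

/-- The Milnor algebra `ℂ{x} / j(f)`. -/
abbrev MilnorAlgebra (f : ConvSeries n) : Type :=
  ConvSeries n ⧸ jacobianIdeal f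

/-- The Milnor number, i.e. the dimension over `ℂ` of the Milnor algebra, possibly `∞`. -/
def milnorNumber (f : ConvSeries n) : ℕ∞ :=
  Cardinal.toENat (Module.rank ℂ (MilnorAlgebra f))

/-- The truncation of a power series up to degree `N`: the sum of its terms of total
degree at most `N`. -/
def truncation (N : ℕ) (f : ConvSeries n) : MvPolynomial (Fin n) ℂ :=
  MvPowerSeries.truncTotal (N + 1) f.1

end ConvSeries

end

open scoped ENNReal NNReal

noncomputable section

/-! The proof is Moser's homotopy method. Let `m` be the ideal of the coordinates, `g` the
truncation of `f` and `F = f + t(g - f)`. Suppose a time-dependent vector field `ξ` satisfies `ξ·F =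
∂F/∂t`. For each `h` the transport equation `∂H/∂t = ξ·H`, `H(0) = h` has a unique solution, and `h
↦ H(1)` is an automorphism. Since `F` is the solution starting at `f`, this automorphism sends `f`
to `F(1) = g`.

Existence of `ξ` (`exists_along_homotopy_eq`): the Milnor algebra has dimension `μ`, so Nakayama
gives `m^μ ⊆ j(f)` (`coordIdeal_pow_le_jacobianIdeal`), hence `m^(N+1) ⊆ m^(N+1-μ) j(f)`. Replacing
`f` by `F` perturbs the resulting linear system by `t` times a matrix over `m`, so it stays
invertible and `g - f = ∑ ξᵢ ∂F/∂xᵢ` with `ξᵢ` of order at least `N+1-μ ≥ 2`. That order also keeps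
the terms of `xᵢ` up to degree `N-μ` fixed.

The flow is built without ODE theory. Order at least two keeps every coefficient polynomial in `t`,
so `H = h + ∫ ξ·H dt` is solved degree by degree (`exists_isTransport`). Convergence at `t = 1`
comes from a weighted `ℓ¹`-norm in which integration in `t` pays for differentiation in `x`
(`wnorm_binom_integrate_mul_pderiv_le`). The inverse is the flow of the time-reversed field. -/

/-- Formal power series in `x₁, …, xₙ` whose coefficients are polynomials in a time parameter. -/
abbrev TimeSeries (n : ℕ) : Type := MvPowerSeries (Fin n) (Polynomial ℂ)

namespace TimeSeries

open MvPowerSeries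

variable {n : ℕ}

/-! ### Orders of power series. -/

theorem natCast_le_order_iff {σ R : Type*} [Semiring R] {k : ℕ} {f : MvPowerSeries σ R} :
    (k : ℕ∞) ≤ f.order ↔ ∀ d : σ →₀ ℕ, d.degree < k → coeff d f = 0 :=
  ⟨fun h _ hd => coeff_of_lt_order ((Nat.cast_lt.mpr hd).trans_le h), nat_le_order⟩

theorem natCast_le_order_mul {σ R : Type*} [Semiring R] {k l : ℕ} {f g : MvPowerSeries σ R}
    (hf : (k : ℕ∞) ≤ f.order) (hg : (l : ℕ∞) ≤ g.order) : ((k + l : ℕ) : ℕ∞) ≤ (f * g).order := by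
  rw [Nat.cast_add]
  exact (add_le_add hf hg).trans le_order_mul

theorem natCast_le_order_add {σ R : Type*} [Semiring R] {k : ℕ} {f g : MvPowerSeries σ R}
    (hf : (k : ℕ∞) ≤ f.order) (hg : (k : ℕ∞) ≤ g.order) : (k : ℕ∞) ≤ (f + g).order :=
  (le_min hf hg).trans min_order_le_add

theorem natCast_le_order_sum {σ R ι : Type*} [Semiring R] {k : ℕ} (s : Finset ι)
    {f : ι → MvPowerSeries σ R} (hf : ∀ i ∈ s, (k : ℕ∞) ≤ (f i).order) :
    (k : ℕ∞) ≤ (∑ i ∈ s, f i).order := by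
  rw [natCast_le_order_iff]
  intro d hd
  rw [map_sum]
  exact Finset.sum_eq_zero fun i hi => natCast_le_order_iff.mp (hf i hi) d hd

theorem natCast_le_order_pderiv {σ R : Type*} [CommSemiring R] {k : ℕ} {f : MvPowerSeries σ R}
    (i : σ) (hf : ((k + 1 : ℕ) : ℕ∞) ≤ f.order) :
    (k : ℕ∞) ≤ (MvPowerSeries.pderiv R i f).order := by
  rw [natCast_le_order_iff] at hf ⊢
  intro d hd
  rw [coeff_pderiv, hf _ (by rw [map_add, Finsupp.degree_single]; omega), zero_mul]

/-! ### Weighted `ℓ¹`-norms. -/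

theorem tsum_sum_antidiagonal {A : Type*} [AddMonoid A] [Finset.HasAntidiagonal A]
    (F : A × A → ℝ≥0∞) :
    ∑' a, ∑ p ∈ Finset.HasAntidiagonal.antidiagonal a, F p = ∑' a, ∑' b, F (a, b) := by
  rw [← ENNReal.tsum_prod, ← Finset.HasAntidiagonal.sigmaAntidiagonalEquivProd.tsum_eq,
    ENNReal.tsum_sigma']
  refine tsum_congr fun a => ?_
  rw [← Finset.tsum_subtype]
  rfl

/-- The weighted `ℓ¹`-norm of a time-dependent series, where the weight of the coefficient of
`x^d t^j` is `W |d| j`. -/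
def wnorm (W : ℕ → ℕ → ℝ≥0∞) (H : TimeSeries n) : ℝ≥0∞ :=
  ∑' d : Fin n →₀ ℕ, ∑' j : ℕ, ‖(coeff d H).coeff j‖ₑ * W d.degree j

theorem wnorm_mono {W V : ℕ → ℕ → ℝ≥0∞} (h : ∀ m j, W m j ≤ V m j) (H : TimeSeries n) :
    wnorm W H ≤ wnorm V H :=
  ENNReal.tsum_le_tsum fun _ => ENNReal.tsum_le_tsum fun _ => by gcongr; exact h _ _

theorem wnorm_zero (W : ℕ → ℕ → ℝ≥0∞) : wnorm W (0 : TimeSeries n) = 0 := by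
  simp [wnorm]

theorem wnorm_add_le (W : ℕ → ℕ → ℝ≥0∞) (H G : TimeSeries n) :
    wnorm W (H + G) ≤ wnorm W H + wnorm W G := by
  simp only [wnorm]
  rw [← ENNReal.tsum_add]
  refine ENNReal.tsum_le_tsum fun d => ?_
  rw [← ENNReal.tsum_add]
  refine ENNReal.tsum_le_tsum fun j => ?_
  rw [← add_mul, map_add, Polynomial.coeff_add]
  gcongr
  exact enorm_add_le _ _

theorem wnorm_neg (W : ℕ → ℕ → ℝ≥0∞) (H : TimeSeries n) : wnorm W (-H) = wnorm W H := by
  simp [wnorm]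

theorem wnorm_sum_le {ι : Type*} (W : ℕ → ℕ → ℝ≥0∞) (s : Finset ι) (H : ι → TimeSeries n) :
    wnorm W (∑ i ∈ s, H i) ≤ ∑ i ∈ s, wnorm W (H i) := by
  classical
  induction s using Finset.induction_on with
  | empty => simp [wnorm_zero]
  | insert a s ha ih =>
    rw [Finset.sum_insert ha, Finset.sum_insert ha]
    exact (wnorm_add_le _ _ _).trans (by gcongr)

/-- Three different weights are allowed because the transport estimate measures the vector field and
the transported series differently. -/
theorem wnorm_mul_le {W W₁ W₂ : ℕ → ℕ → ℝ≥0∞}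
    (h : ∀ m k i j, W (m + k) (i + j) ≤ W₁ m i * W₂ k j) (H G : TimeSeries n) :
    wnorm W (H * G) ≤ wnorm W₁ H * wnorm W₂ G := by
  classical
  let F : (Fin n →₀ ℕ) → ℕ → ℝ≥0∞ := fun d j => ‖(coeff d H).coeff j‖ₑ * W₁ d.degree j
  let E : (Fin n →₀ ℕ) → ℕ → ℝ≥0∞ := fun d j => ‖(coeff d G).coeff j‖ₑ * W₂ d.degree j
  calc wnorm W (H * G)
      ≤ ∑' d, ∑' j, ∑ p ∈ Finset.HasAntidiagonal.antidiagonal d,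
          ∑ q ∈ Finset.HasAntidiagonal.antidiagonal j,
          F p.1 q.1 * E p.2 q.2 := by
        refine ENNReal.tsum_le_tsum fun d => ENNReal.tsum_le_tsum fun j => ?_
        rw [coeff_mul, Polynomial.finsetSum_coeff]
        refine (mul_le_mul_left (enorm_sum_le _ _) _).trans ?_
        rw [Finset.sum_mul]
        refine Finset.sum_le_sum fun p hp => ?_
        rw [Polynomial.coeff_mul]
        refine (mul_le_mul_left (enorm_sum_le _ _) _).trans ?_
        rw [Finset.sum_mul]
        refine Finset.sum_le_sum fun q hq => ?_
        rw [← Finset.HasAntidiagonal.mem_antidiagonal.mp hp,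
          ← Finset.HasAntidiagonal.mem_antidiagonal.mp hq, map_add, enorm_mul]
        refine (mul_le_mul_right (h _ _ _ _) _).trans_eq ?_
        simp only [F, E]
        ring
    _ = ∑' d, ∑ p ∈ Finset.HasAntidiagonal.antidiagonal d, (∑' j, F p.1 j) * (∑' j, E p.2 j) := by
        refine tsum_congr fun d => ?_
        rw [Summable.tsum_finsetSum fun _ _ => ENNReal.summable]
        refine Finset.sum_congr rfl fun p _ => ?_
        rw [tsum_sum_antidiagonal fun q : ℕ × ℕ => F p.1 q.1 * E p.2 q.2]
        simp_rw [ENNReal.tsum_mul_left, ENNReal.tsum_mul_right]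
    _ = wnorm W₁ H * wnorm W₂ G := by
        rw [tsum_sum_antidiagonal fun p : (Fin n →₀ ℕ) × (Fin n →₀ ℕ) =>
          (∑' j, F p.1 j) * (∑' j, E p.2 j)]
        simp_rw [ENNReal.tsum_mul_left, ENNReal.tsum_mul_right]
        rfl

theorem wnorm_pderiv_le {W V : ℕ → ℕ → ℝ≥0∞} (h : ∀ m j : ℕ, ((m : ℝ≥0∞) + 1) * V m j ≤ W (m + 1) j)
    (i : Fin n) (H : TimeSeries n) :
    wnorm V (MvPowerSeries.pderiv (Polynomial ℂ) i H) ≤ wnorm W H := by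
  refine le_trans (ENNReal.tsum_le_tsum fun d => ?_)
    (ENNReal.tsum_comp_le_tsum_of_injective (add_left_injective (Finsupp.single i 1))
      fun d : Fin n →₀ ℕ => ∑' j : ℕ, ‖(coeff d H).coeff j‖ₑ * W d.degree j)
  refine ENNReal.tsum_le_tsum fun j => ?_
  have h1 : (coeff (d + Finsupp.single i 1) H * ((d i : Polynomial ℂ) + 1)).coeff j
      = (coeff (d + Finsupp.single i 1) H).coeff j * ((d i + 1 : ℕ) : ℂ) := by
    rw [← Polynomial.coeff_mul_natCast]
    push_cast
    rfl
  have h2 : ‖((d i + 1 : ℕ) : ℂ)‖ₑ ≤ (d.degree : ℝ≥0∞) + 1 := by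
    have : ‖((d i + 1 : ℕ) : ℂ)‖ₑ = ((d i + 1 : ℕ) : ℝ≥0∞) := by
      rw [← ofReal_norm, Complex.norm_natCast, ENNReal.ofReal_natCast]
    rw [this]
    exact_mod_cast Nat.succ_le_succ (Finsupp.le_degree i d)
  rw [coeff_pderiv, h1, enorm_mul, map_add, Finsupp.degree_single, mul_assoc]
  gcongr
  exact le_trans (by gcongr) (h _ _)

/-! ### Fixed points of order-raising maps. -/

/-- A contraction that raises the order has a fixed point through every `u`, and the weighted
norms are controlled by those of `u`. -/
theorem exists_eq_add_apply (T : TimeSeries n →+ TimeSeries n)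
    (hT : ∀ (k : ℕ) (H : TimeSeries n), (k : ℕ∞) ≤ H.order → ((k + 1 : ℕ) : ℕ∞) ≤ (T H).order)
    (u : TimeSeries n) :
    ∃ v, v = u + T v ∧ ∀ W : ℕ → ℕ → ℝ≥0∞, (∀ H, wnorm W (T H) ≤ 2⁻¹ * wnorm W H) →
      wnorm W v ≤ 2 * wnorm W u := by
  let s : ℕ → TimeSeries n := fun k => (fun H => u + T H)^[k] 0
  have hs : ∀ k, s (k + 1) = u + T (s k) := fun k => Function.iterate_succ_apply' _ _ _
  have hdiff : ∀ k : ℕ, (k : ℕ∞) ≤ (s (k + 1) - s k).order := by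
    intro k
    induction k with
    | zero => simp
    | succ k ih =>
      have : s (k + 1 + 1) - s (k + 1) = T (s (k + 1) - s k) := by
        rw [hs (k + 1), map_sub, ← add_sub_add_left_eq_sub (T (s (k + 1))) _ u, ← hs k]
      rw [this]
      exact hT k _ ih
  have hstep : ∀ (d : Fin n →₀ ℕ) (k : ℕ), d.degree < k → coeff d (s k) =
      coeff d (s (d.degree + 1)) := by
    intro d k hk
    induction k, hk using Nat.le_induction with
    | base => rfl
    | succ k hk ih =>
      rw [← ih, ← sub_eq_zero, ← map_sub]
      exact natCast_le_order_iff.mp (hdiff k) d hk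
  -- The `k`-th iterate is already final in degrees below `k`, so the limit is read off
  -- coefficientwise and no completeness is needed.
  let v : TimeSeries n := fun d => coeff d (s (d.degree + 1))
  have hv : ∀ (d : Fin n →₀ ℕ) (k : ℕ), d.degree < k → coeff d v = coeff d (s k) :=
    fun d k hk => (hstep d k hk).symm
  refine ⟨v, ?_, fun W hW => ?_⟩
  · ext1 d
    have h1 : ((d.degree + 1 : ℕ) : ℕ∞) ≤ (v - s (d.degree + 1)).order := by
      rw [natCast_le_order_iff]
      intro e he
      rw [map_sub, hv e _ he, sub_self]
    have h2 := natCast_le_order_iff.mp (hT _ _ h1) d (by omega)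
    rw [map_sub, map_sub, sub_eq_zero] at h2
    rw [map_add, h2, ← map_add, ← hs]
    exact hv d _ (by omega)
  · have hsn : ∀ k, wnorm W (s k) ≤ 2 * wnorm W u := by
      intro k
      induction k with
      | zero => simp [s, wnorm_zero]
      | succ k ih =>
        rw [hs]
        calc wnorm W (u + T (s k)) ≤ wnorm W u + 2⁻¹ * (2 * wnorm W u) :=
              (wnorm_add_le _ _ _).trans (by gcongr; exact (hW _).trans (by gcongr))
          _ = 2 * wnorm W u := by
              rw [← mul_assoc, ENNReal.inv_mul_cancel two_ne_zero ENNReal.ofNat_ne_top, one_mul,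
                two_mul]
    rw [wnorm, ENNReal.tsum_eq_iSup_sum]
    refine iSup_le fun S => ?_
    -- Each finite partial sum of the norm of `v` is one of a single iterate, which `hsn` bounds.
    obtain ⟨k, hk⟩ : ∃ k, ∀ d ∈ S, d.degree < k :=
      ⟨S.sup Finsupp.degree + 1, fun d hd =>
        Nat.lt_succ_of_le (Finset.le_sup (f := Finsupp.degree) hd)⟩
    calc _ = ∑ d ∈ S, ∑' j : ℕ, ‖(coeff d (s k)).coeff j‖ₑ * W d.degree j :=
          Finset.sum_congr rfl fun d hd => by rw [hv d k (hk d hd)]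
      _ ≤ wnorm W (s k) := ENNReal.sum_le_tsum S
      _ ≤ _ := hsn k

/-! ### Geometric weights and convergent time-dependent series. -/

/-- The weight of the norm `∑ |c_{d,j}| r^|d| K^j`. -/
def geom (r K : ℝ≥0) (m j : ℕ) : ℝ≥0∞ := r ^ m * K ^ j

theorem geom_add (r K : ℝ≥0) (m k i j : ℕ) :
    geom r K (m + k) (i + j) = geom r K m i * geom r K k j := by
  simp only [geom, pow_add]
  ring

theorem wnorm_geom_mul_le (r K : ℝ≥0) (H G : TimeSeries n) :
    wnorm (geom r K) (H * G) ≤ wnorm (geom r K) H * wnorm (geom r K) G :=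
  wnorm_mul_le (fun m k i j => (geom_add r K m k i j).le) H G

theorem wnorm_geom_mono {r s : ℝ≥0} (h : r ≤ s) (K : ℝ≥0) (H : TimeSeries n) :
    wnorm (geom r K) H ≤ wnorm (geom s K) H :=
  wnorm_mono (fun m j => by unfold geom; gcongr) H

theorem wnorm_geom_le_of_le_order {r s : ℝ≥0} (hs : 0 < s) (h : r ≤ s) (K : ℝ≥0) {k : ℕ}
    {H : TimeSeries n} (hH : (k : ℕ∞) ≤ H.order) :
    wnorm (geom r K) H ≤ ((r / s) ^ k : ℝ≥0) * wnorm (geom s K) H := by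
  simp only [wnorm, ← ENNReal.tsum_mul_left]
  refine ENNReal.tsum_le_tsum fun d => ENNReal.tsum_le_tsum fun j => ?_
  rcases lt_or_ge d.degree k with hd | hd
  · simp [natCast_le_order_iff.mp hH d hd]
  · obtain ⟨l, hl⟩ := Nat.exists_eq_add_of_le hd
    have : r ^ (k + l) ≤ (r / s) ^ k * s ^ (k + l) := by
      rw [pow_add, pow_add, ← mul_assoc, ← mul_pow, div_mul_cancel₀ _ hs.ne']
      gcongr
    have h' : (r : ℝ≥0∞) ^ (k + l) ≤ ((r / s) ^ k : ℝ≥0) * (s : ℝ≥0∞) ^ (k + l) := by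
      exact_mod_cast this
    rw [geom, geom, hl]
    calc _ ≤ ‖(coeff d H).coeff j‖ₑ
          * (((r / s) ^ k : ℝ≥0) * (s : ℝ≥0∞) ^ (k + l) * (K : ℝ≥0∞) ^ j) := by gcongr
      _ = _ := by ring

/-- Order `k + 1` makes the norm `O(r^(k+1))`; one factor `r` is spent on making the constant as
small as desired. -/
theorem exists_wnorm_geom_le {ρ K C : ℝ≥0} (hρ : 0 < ρ) (hC : 0 < C) {k : ℕ} {H : TimeSeries n}
    (hfin : wnorm (geom ρ K) H ≠ ⊤) (hH : ((k + 1 : ℕ) : ℕ∞) ≤ H.order) :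
    ∃ δ : ℝ≥0, 0 < δ ∧ ∀ r : ℝ≥0, r ≤ δ →
      wnorm (geom r K) H ≤ C * r ^ k := by
  obtain ⟨M, hM⟩ : ∃ M : ℝ≥0, (M : ℝ≥0∞) = wnorm (geom ρ K) H := ⟨_, ENNReal.coe_toNNReal hfin⟩
  refine ⟨min ρ (C * ρ ^ (k + 1) / (M + 1)), by positivity, fun r hr => ?_⟩
  refine (wnorm_geom_le_of_le_order hρ (hr.trans (min_le_left _ _)) K hH).trans ?_
  rw [← hM]
  have h2 : r * (M + 1) ≤ C * ρ ^ (k + 1) := by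
    rw [← le_div_iff₀ (by positivity)]
    exact hr.trans (min_le_right _ _)
  have h3 : (r / ρ) ^ (k + 1) * M ≤ C * r ^ k := by
    rw [div_pow, div_mul_eq_mul_div, div_le_iff₀ (by positivity)]
    calc r ^ (k + 1) * M ≤ r ^ (k + 1) * (M + 1) := by gcongr; simp
      _ = r ^ k * (r * (M + 1)) := by ring
      _ ≤ r ^ k * (C * ρ ^ (k + 1)) := by gcongr
      _ = _ := by ring
  exact_mod_cast h3

theorem wnorm_geom_C_le (r K : ℝ≥0) (p : Polynomial ℂ) :
    wnorm (geom r K) (C p : TimeSeries n) = ∑' j, ‖p.coeff j‖ₑ * K ^ j := by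
  classical
  rw [wnorm, tsum_eq_single 0]
  · simp [geom]
  · intro d hd
    simp [coeff_C, hd]

theorem tsum_coeff_ne_top (K : ℝ≥0) (p : Polynomial ℂ) :
    ∑' j, ‖p.coeff j‖ₑ * (K : ℝ≥0∞) ^ j ≠ ⊤ := by
  rw [tsum_eq_sum (s := p.support) fun j hj => by simp [Polynomial.notMem_support_iff.mp hj]]
  refine (ENNReal.sum_lt_top.mpr fun j _ => ?_).ne
  exact ENNReal.mul_lt_top enorm_lt_top (ENNReal.pow_lt_top ENNReal.coe_lt_top)

/-- The time-dependent series which converge absolutely for `|t| ≤ K` and small `x`. -/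
def convergent (n : ℕ) (K : ℝ≥0) : Subring (TimeSeries n) where
  carrier := {H | ∃ r : ℝ≥0, 0 < r ∧ wnorm (geom r K) H ≠ ⊤}
  mul_mem' := by
    rintro H G ⟨r, hr, hH⟩ ⟨s, hs, hG⟩
    refine ⟨min r s, lt_min hr hs, ne_top_of_le_ne_top ?_ (wnorm_geom_mul_le _ _ _ _)⟩
    exact ENNReal.mul_ne_top (ne_top_of_le_ne_top hH (wnorm_geom_mono (min_le_left _ _) _ _))
      (ne_top_of_le_ne_top hG (wnorm_geom_mono (min_le_right _ _) _ _))
  one_mem' := by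
    refine ⟨1, one_pos, ?_⟩
    rw [← map_one C, wnorm_geom_C_le]
    exact tsum_coeff_ne_top _ _
  zero_mem' := ⟨1, one_pos, by simp [wnorm_zero]⟩
  add_mem' := by
    rintro H G ⟨r, hr, hH⟩ ⟨s, hs, hG⟩
    refine ⟨min r s, lt_min hr hs, ne_top_of_le_ne_top ?_ (wnorm_add_le _ _ _)⟩
    exact ENNReal.add_ne_top.mpr
      ⟨ne_top_of_le_ne_top hH (wnorm_geom_mono (min_le_left _ _) _ _),
        ne_top_of_le_ne_top hG (wnorm_geom_mono (min_le_right _ _) _ _)⟩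
  neg_mem' := by
    rintro H ⟨r, hr, hH⟩
    exact ⟨r, hr, by rwa [wnorm_neg]⟩

theorem C_mem_convergent (K : ℝ≥0) (p : Polynomial ℂ) : (C p : TimeSeries n) ∈ convergent n K :=
  ⟨1, one_pos, by rw [wnorm_geom_C_le]; exact tsum_coeff_ne_top _ _⟩

/-- Geometric series: with `H = 1 - P`, the inverse solves `v = 1 + P * v`, and multiplication by
`P` raises the order and has norm at most `1/2` for small radius. The constant coefficient being
`1`, the inverse again has polynomial coefficients in `t`, so no restriction on `t` arises. -/
theorem isUnit_of_constantCoeff_eq_one {K : ℝ≥0} (H : convergent n K)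
    (h : constantCoeff (H : TimeSeries n) = 1) : IsUnit H := by
  obtain ⟨P, hP⟩ : ∃ P : TimeSeries n, P = 1 - H := ⟨_, rfl⟩
  have hPo : ((0 + 1 : ℕ) : ℕ∞) ≤ P.order := by
    rw [natCast_le_order_iff]
    intro d hd
    obtain rfl : d = 0 := (Finsupp.degree_eq_zero_iff d).mp (by omega)
    simp [hP, h]
  obtain ⟨ρ, hρ, hfin⟩ : P ∈ convergent n K := hP ▸ sub_mem (one_mem _) H.2
  obtain ⟨δ, hδ, hle⟩ := exists_wnorm_geom_le (C := 2⁻¹) hρ (by positivity) hfin hPo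
  obtain ⟨v, hv, hvn⟩ := exists_eq_add_apply (AddMonoidHom.mulLeft P)
    (fun k G hG => by
      rw [add_comm]
      exact natCast_le_order_mul (by simpa using hPo) hG) 1
  have hvK : v ∈ convergent n K := by
    refine ⟨δ, hδ, ne_top_of_le_ne_top ?_ (hvn (geom δ K) fun G => ?_)⟩
    · rw [← map_one C, wnorm_geom_C_le]
      exact ENNReal.mul_ne_top ENNReal.ofNat_ne_top (tsum_coeff_ne_top _ _)
    · refine (wnorm_geom_mul_le _ _ _ _).trans ?_
      gcongr
      have := hle δ le_rfl
      rw [pow_zero, mul_one] at this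
      simpa using this
  refine IsUnit.of_mul_eq_one ⟨v, hvK⟩ (Subtype.ext ?_)
  have h1 : (H : TimeSeries n) = 1 - P := by rw [hP]; ring
  change (H : TimeSeries n) * v = 1
  have h2 : v = 1 + P * v := hv
  rw [h1, sub_mul, one_mul, sub_eq_iff_eq_add]
  exact h2

/-! ### Differentiation and integration in time. -/

/-- The primitive of a polynomial which vanishes at `0`. -/
def primitive : Polynomial ℂ →ₗ[ℂ] Polynomial ℂ :=
  Polynomial.lsum fun j => ((j : ℂ) + 1)⁻¹ • Polynomial.monomial (j + 1)

theorem primitive_monomial (j : ℕ) (a : ℂ) : primitive (Polynomial.monomial j a) =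
    Polynomial.monomial (j + 1) (((j : ℂ) + 1)⁻¹ * a) := by
  rw [primitive, Polynomial.lsum_apply, Polynomial.sum_monomial_index _ _ (by simp)]
  simp [Polynomial.smul_monomial]

theorem coeff_primitive_succ (p : Polynomial ℂ) (j : ℕ) :
    (primitive p).coeff (j + 1) = ((j : ℂ) + 1)⁻¹ * p.coeff j := by
  induction p using Polynomial.induction_on' with
  | add p q hp hq => simp only [map_add, Polynomial.coeff_add, hp, hq, mul_add]
  | monomial k a =>
    rw [primitive_monomial, Polynomial.coeff_monomial, Polynomial.coeff_monomial]
    rcases eq_or_ne k j with rfl | h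
    · simp
    · simp [h]

theorem coeff_primitive_zero (p : Polynomial ℂ) : (primitive p).coeff 0 = 0 := by
  induction p using Polynomial.induction_on' with
  | add p q hp hq => simp only [map_add, Polynomial.coeff_add, hp, hq, add_zero]
  | monomial k a => simp [primitive_monomial, Polynomial.coeff_monomial]

theorem derivative_primitive (p : Polynomial ℂ) : (primitive p).derivative = p := by
  ext j
  have : (j : ℂ) + 1 ≠ 0 := by exact_mod_cast j.succ_ne_zero
  rw [Polynomial.coeff_derivative, coeff_primitive_succ]
  field_simp

/-- The map on power series obtained by applying an additive map to every coefficient. -/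
def coeffwise {σ R : Type*} [Semiring R] (φ : R →+ R) : MvPowerSeries σ R →+ MvPowerSeries σ R where
  toFun H := fun d => φ (coeff d H)
  map_zero' := funext fun _ => φ.map_zero
  map_add' _ _ := funext fun _ => φ.map_add _ _

/-- The derivative with respect to time. -/
def dt : TimeSeries n →+ TimeSeries n := coeffwise Polynomial.derivative.toAddMonoidHom

theorem coeff_dt (H : TimeSeries n) (d : Fin n →₀ ℕ) :
    coeff d (dt H) = (coeff d H).derivative := rfl

theorem dt_mul (H G : TimeSeries n) : dt (H * G) = dt H * G + H * dt G := by
  classical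
  ext1 d
  rw [coeff_dt, map_add, coeff_mul, coeff_mul, coeff_mul, map_sum, ← Finset.sum_add_distrib]
  exact Finset.sum_congr rfl fun p _ => Polynomial.derivative_mul

theorem dt_map_C (h : MvPowerSeries (Fin n) ℂ) : dt (map Polynomial.C h) = 0 := by
  ext1 d
  simp [coeff_dt]

theorem pderiv_map {σ R S : Type*} [CommSemiring R] [CommSemiring S] (φ : R →+* S) (i : σ)
    (f : MvPowerSeries σ R) :
    MvPowerSeries.pderiv S i (map φ f) = map φ (MvPowerSeries.pderiv R i f) := by
  ext d
  simp [coeff_pderiv]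

/-- Integration with respect to time, starting at time `0`. -/
def integrate : TimeSeries n →+ TimeSeries n := coeffwise primitive.toAddMonoidHom

theorem coeff_integrate (H : TimeSeries n) (d : Fin n →₀ ℕ) :
    coeff d (integrate H) = primitive (coeff d H) := rfl

theorem dt_integrate (H : TimeSeries n) : dt (integrate H) = H := by
  ext1 d
  rw [coeff_dt, coeff_integrate, derivative_primitive]

theorem natCast_le_order_integrate {k : ℕ} {H : TimeSeries n} (h : (k : ℕ∞) ≤ H.order) :
    (k : ℕ∞) ≤ (integrate H).order := by
  rw [natCast_le_order_iff] at h ⊢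
  intro d hd
  rw [coeff_integrate, h d hd, map_zero]

theorem wnorm_integrate_le {W V : ℕ → ℕ → ℝ≥0∞}
    (h : ∀ m j : ℕ, W m (j + 1) ≤ ((j : ℝ≥0∞) + 1) * V m j) (H : TimeSeries n) :
    wnorm W (integrate H) ≤ wnorm V H := by
  refine ENNReal.tsum_le_tsum fun d => ?_
  rw [tsum_eq_zero_add' ENNReal.summable]
  simp only [coeff_integrate, coeff_primitive_zero, enorm_zero, zero_mul, zero_add]
  refine ENNReal.tsum_le_tsum fun j => ?_
  have h1 : ‖((j : ℂ) + 1)⁻¹‖ₑ * ((j : ℝ≥0∞) + 1) = 1 := by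
    have h2 : ‖(j : ℂ) + 1‖ₑ = (j : ℝ≥0∞) + 1 := by
      have : ‖((j + 1 : ℕ) : ℂ)‖ₑ = ((j + 1 : ℕ) : ℝ≥0∞) := by
        rw [← ofReal_norm, Complex.norm_natCast, ENNReal.ofReal_natCast]
      exact_mod_cast this
    rw [← h2, ← enorm_mul, inv_mul_cancel₀ (by exact_mod_cast j.succ_ne_zero)]
    simp
  rw [coeff_primitive_succ, enorm_mul]
  calc _ ≤ ‖((j : ℂ) + 1)⁻¹‖ₑ * ‖(coeff d H).coeff j‖ₑ * (((j : ℝ≥0∞) + 1) * V d.degree j) := by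
        gcongr
        exact h _ _
    _ = (‖((j : ℂ) + 1)⁻¹‖ₑ * ((j : ℝ≥0∞) + 1)) * (‖(coeff d H).coeff j‖ₑ * V d.degree j) := by
        ring
    _ = _ := by rw [h1, one_mul]

/-! ### Integration in time against differentiation in space. -/

/-- The weight `r^|d| K^j / binom(|d| + j, j)`, for which integration in time compensates
differentiation in space. -/
def binom (r K : ℝ≥0) (m j : ℕ) : ℝ≥0∞ := ((r ^ m * K ^ j / ((m + j).choose j : ℕ) : ℝ≥0) : ℝ≥0∞)

/-- By absorption the right side equals `(m + k + 1) * (m + k + (i + j + 1)).choose (i + j)`, which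
dominates factor by factor. -/
theorem succ_mul_choose_le (m k i j : ℕ) :
    (k + 1) * (k + 1 + j).choose j ≤ (i + j + 1) * (m + k + (i + j + 1)).choose (i + j + 1) := by
  have h1 : (k + 1 + j).choose j ≤ (m + k + (i + j + 1)).choose (i + j) := by
    rw [show m + k + (i + j + 1) = m + k + 1 + (i + j) by ring,
      ← Nat.choose_symm_add, ← Nat.choose_symm_add]
    calc (k + 1 + j).choose (k + 1) ≤ (k + 1 + (i + j)).choose (k + 1) :=
          Nat.choose_le_choose _ (by omega)
      _ = (k + 1 + (i + j)).choose (i + j) := Nat.choose_symm_add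
      _ ≤ (m + k + 1 + (i + j)).choose (i + j) := Nat.choose_le_choose _ (by omega)
      _ = _ := Nat.choose_symm_add.symm
  have h2 := Nat.choose_succ_right_eq (m + k + (i + j + 1)) (i + j)
  rw [show m + k + (i + j + 1) - (i + j) = m + k + 1 by omega] at h2
  calc (k + 1) * (k + 1 + j).choose j ≤ (m + k + 1) * (m + k + (i + j + 1)).choose (i + j) :=
        Nat.mul_le_mul (by omega) h1
    _ = _ := by linarith

/-- Differentiation costs a factor up to `|d|` and integration gains `1/(j+1)`; the binomial
denominators make the two cancel. What remains is `K` for the extra power of `t` and `1/r` for the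
lost power of `x`. -/
theorem wnorm_binom_integrate_mul_pderiv_le {r : ℝ≥0} (hr : 0 < r) (K : ℝ≥0) (i : Fin n)
    (G H : TimeSeries n) :
    wnorm (binom r K) (integrate (G * MvPowerSeries.pderiv (Polynomial ℂ) i H)) ≤
      (K / r : ℝ≥0) * wnorm (geom r K) G * wnorm (binom r K) H := by
  let V : ℕ → ℕ → ℝ≥0∞ := fun m j => (((j : ℝ≥0) + 1)⁻¹ : ℝ≥0) * binom r K m (j + 1)
  let V₂ : ℕ → ℕ → ℝ≥0∞ := fun m j => (((m : ℝ≥0) + 1)⁻¹ : ℝ≥0) * binom r K (m + 1) j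
  let V₁ : ℕ → ℕ → ℝ≥0∞ := fun m j => (K / r : ℝ≥0) * geom r K m j
  have key : ∀ m : ℕ, ∀ x : ℝ≥0∞, ((m : ℝ≥0∞) + 1) * ((((m : ℝ≥0) + 1)⁻¹ : ℝ≥0) * x) = x := by
    intro m x
    rw [← mul_assoc]
    have : ((m : ℝ≥0) + 1) * ((m : ℝ≥0) + 1)⁻¹ = 1 := mul_inv_cancel₀ (by positivity)
    have h' : ((m : ℝ≥0∞) + 1) * (((m : ℝ≥0) + 1)⁻¹ : ℝ≥0) = 1 := by exact_mod_cast this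
    rw [h', one_mul]
  have h1 : wnorm (binom r K) (integrate (G * MvPowerSeries.pderiv (Polynomial ℂ) i H)) ≤
      wnorm V (G * MvPowerSeries.pderiv (Polynomial ℂ) i H) :=
    wnorm_integrate_le (fun m j => (key j _).ge) _
  have h2 : wnorm V₂ (MvPowerSeries.pderiv (Polynomial ℂ) i H) ≤ wnorm (binom r K) H :=
    wnorm_pderiv_le (fun m j => (key m _).le) _ _
  have h3 : wnorm V₁ G = (K / r : ℝ≥0) * wnorm (geom r K) G := by
    simp only [wnorm, ← ENNReal.tsum_mul_left, V₁]
    refine tsum_congr fun d => tsum_congr fun j => by ring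
  rw [← h3]
  refine h1.trans ((wnorm_mul_le (W₁ := V₁) (W₂ := V₂) (fun m k a b => ?_) _ _).trans (by gcongr))
  have hc : ((k : ℝ≥0) + 1) * ((k + 1 + b).choose b : ℕ) ≤
      ((a + b : ℕ) + 1 : ℝ≥0) * ((m + k + (a + b + 1)).choose (a + b + 1) : ℕ) := by
    exact_mod_cast succ_mul_choose_le m k a b
  have hp : (0 : ℝ≥0) < ((k + 1 + b).choose b : ℕ) := by
    exact_mod_cast Nat.choose_pos (by omega)
  simp only [V, V₁, V₂, binom, geom]
  have : ((a + b : ℕ) + 1 : ℝ≥0)⁻¹ *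
      (r ^ (m + k) * K ^ (a + b + 1) / ((m + k + (a + b + 1)).choose (a + b + 1) : ℕ)) ≤
      K / r * (r ^ m * K ^ a) *
        (((k : ℝ≥0) + 1)⁻¹ * (r ^ (k + 1) * K ^ b / ((k + 1 + b).choose b : ℕ))) := by
    calc _ = (r ^ (m + k) * K ^ (a + b + 1)) * (((a + b : ℕ) + 1 : ℝ≥0) *
          ((m + k + (a + b + 1)).choose (a + b + 1) : ℕ))⁻¹ := by
          rw [mul_inv]; ring
      _ ≤ (r ^ (m + k) * K ^ (a + b + 1)) *
          (((k : ℝ≥0) + 1) * ((k + 1 + b).choose b : ℕ))⁻¹ := by gcongr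
      _ = _ := by
          rw [mul_inv]
          field_simp
          ring
  exact_mod_cast this

/-- The binomial is at most `2^(m+j)`: the choice `K = 2` absorbs `2^j`, and halving the radius
absorbs `2^m`. This returns from the binomial weight to convergence at `|t| ≤ 1`. -/
theorem le_binom_two (r : ℝ≥0) (m j : ℕ) : geom (r / 2) 1 m j ≤ binom r 2 m j := by
  have hp : (0 : ℝ≥0) < ((m + j).choose j : ℕ) := by
    exact_mod_cast Nat.choose_pos (by omega)
  have h : (((m + j).choose j : ℕ) : ℝ≥0) ≤ 2 ^ (m + j) := by
    exact_mod_cast Nat.choose_le_two_pow _ _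
  have : (r / 2) ^ m * 1 ^ j ≤ r ^ m * 2 ^ j / ((m + j).choose j : ℕ) := by
    rw [le_div_iff₀ hp, one_pow, mul_one, div_pow, div_mul_eq_mul_div, div_le_iff₀ (by positivity)]
    calc _ ≤ r ^ m * 2 ^ (m + j) := by gcongr
      _ = _ := by ring
  unfold geom binom
  exact_mod_cast this

/-! ### The transport equation. -/

/-- The derivation along the time-dependent vector field `ξ`. -/
def along (ξ : Fin n → TimeSeries n) : TimeSeries n →+ TimeSeries n :=
  ∑ i, (AddMonoidHom.mulLeft (ξ i)).comp
    (MvPowerSeries.pderiv (Polynomial ℂ) i).toLinearMap.toAddMonoidHom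

theorem along_apply (ξ : Fin n → TimeSeries n) (H : TimeSeries n) :
    along ξ H = ∑ i, ξ i * MvPowerSeries.pderiv (Polynomial ℂ) i H := by
  simp [along, AddMonoidHom.finsetSum_apply]

theorem along_mul (ξ : Fin n → TimeSeries n) (H G : TimeSeries n) :
    along ξ (H * G) = along ξ H * G + H * along ξ G := by
  simp only [along_apply, Finset.sum_mul, Finset.mul_sum, ← Finset.sum_add_distrib]
  refine Finset.sum_congr rfl fun i _ => ?_
  rw [Derivation.leibniz, smul_eq_mul, smul_eq_mul]
  ring

theorem natCast_le_order_along {ξ : Fin n → TimeSeries n} {l : ℕ}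
    (hξ : ∀ i, ((l + 1 : ℕ) : ℕ∞) ≤ (ξ i).order) (k : ℕ) {H : TimeSeries n}
    (hH : (k : ℕ∞) ≤ H.order) : ((k + l : ℕ) : ℕ∞) ≤ (along ξ H).order := by
  rw [along_apply]
  refine natCast_le_order_sum _ fun i _ => ?_
  cases k with
  | zero =>
    refine le_trans (by exact_mod_cast (by omega : 0 + l ≤ l + 1 + 0))
      (natCast_le_order_mul (hξ i) (l := 0) (by simp))
  | succ k =>
    rw [show k + 1 + l = l + 1 + k by ring]
    exact natCast_le_order_mul (hξ i) (natCast_le_order_pderiv i hH)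

/-- `H` is the solution of the transport equation of `ξ` with value `h` at time `0`. -/
structure IsTransport (ξ : Fin n → TimeSeries n) (h : MvPowerSeries (Fin n) ℂ)
    (H : TimeSeries n) : Prop where
  dt_eq : dt H = along ξ H
  map_zero_eq : map (Polynomial.evalRingHom 0) H = h

/-- A difference of solutions of order `k` has time derivative of order `k + 1`, so its terms of
degree `k` are constant in time, and they vanish at time `0`. Hence its order is infinite. -/
theorem IsTransport.unique {ξ : Fin n → TimeSeries n} (hξ : ∀ i, (2 : ℕ∞) ≤ (ξ i).order)
    {h : MvPowerSeries (Fin n) ℂ} {H G : TimeSeries n} (hH : IsTransport ξ h H)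
    (hG : IsTransport ξ h G) : H = G := by
  rw [← sub_eq_zero]
  have h1 : dt (H - G) = along ξ (H - G) := by
    rw [map_sub, map_sub, hH.dt_eq, hG.dt_eq]
  have h2 : map (Polynomial.evalRingHom 0) (H - G) = 0 := by
    rw [map_sub, hH.map_zero_eq, hG.map_zero_eq, sub_self]
  have h3 : ∀ k : ℕ, (k : ℕ∞) ≤ (H - G).order := by
    intro k
    induction k with
    | zero => simp
    | succ k ih =>
      have h4 := natCast_le_order_along (l := 1) hξ k ih
      rw [← h1] at h4
      rw [natCast_le_order_iff] at h4 ⊢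
      intro d hd
      have h5 := h4 d hd
      rw [coeff_dt] at h5
      have h6 := congrArg (coeff d) h2
      rw [coeff_map, map_zero] at h6
      obtain ⟨a, ha⟩ : ∃ a, coeff d (H - G) = Polynomial.C a :=
        ⟨_, Polynomial.eq_C_of_derivative_eq_zero h5⟩
      rw [ha] at h6 ⊢
      rw [show a = 0 by simpa using h6, map_zero]
  ext1 d
  exact natCast_le_order_iff.mp (h3 (d.degree + 1)) d (by omega)

/-- The solution is the fixed point of `H = h + ∫ ξ·H dt`. A single formal solution serves all `r`
and `K`, so the radius may be chosen afterwards. -/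
theorem exists_isTransport {ξ : Fin n → TimeSeries n} (hξ : ∀ i, (2 : ℕ∞) ≤ (ξ i).order)
    (h : MvPowerSeries (Fin n) ℂ) :
    ∃ H, IsTransport ξ h H ∧ ∀ r K : ℝ≥0, 0 < r →
      ∑ i, (K / r : ℝ≥0) * wnorm (geom r K) (ξ i) ≤ 2⁻¹ →
      wnorm (binom r K) H ≤ 2 * wnorm (binom r K) (map Polynomial.C h : TimeSeries n) := by
  obtain ⟨H, hH, hn⟩ := exists_eq_add_apply (integrate.comp (along ξ))
    (fun k G hG => natCast_le_order_integrate (natCast_le_order_along (l := 1) hξ k hG))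
    (map Polynomial.C h)
  have hH' : H = map Polynomial.C h + integrate (along ξ H) := hH
  refine ⟨H, ⟨?_, ?_⟩, fun r K hr hle => hn _ fun G => ?_⟩
  · conv_lhs => rw [hH', map_add, dt_map_C, dt_integrate, zero_add]
  · ext d
    rw [hH', coeff_map, map_add, coeff_integrate, coeff_map]
    simp [← Polynomial.coeff_zero_eq_eval_zero, coeff_primitive_zero]
  · change wnorm _ (integrate (along ξ G)) ≤ _
    rw [along_apply, map_sum]
    refine (wnorm_sum_le _ _ _).trans ?_
    refine le_trans (Finset.sum_le_sum fun i _ =>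
      wnorm_binom_integrate_mul_pderiv_le hr K i (ξ i) G) ?_
    rw [← Finset.sum_mul]
    gcongr

/-! ### Reversal of time. -/

/-- Reversal of time on the interval from `0` to `1`. -/
def reverse : TimeSeries n →+* TimeSeries n :=
  map (Polynomial.compRingHom (1 - Polynomial.X))

theorem dt_reverse (H : TimeSeries n) : dt (reverse H) = -reverse (dt H) := by
  ext1 d
  rw [coeff_dt, map_neg, reverse, coeff_map, coeff_map, coeff_dt, Polynomial.coe_compRingHom_apply,
    Polynomial.coe_compRingHom_apply, Polynomial.derivative_comp]
  simp

theorem along_reverse (ξ : Fin n → TimeSeries n) (H : TimeSeries n) :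
    along (fun i => -reverse (ξ i)) (reverse H) = -reverse (along ξ H) := by
  simp [along_apply, reverse, pderiv_map, map_sum]

theorem map_eval_reverse (a b : ℂ) (hab : 1 - a = b) (H : TimeSeries n) :
    map (Polynomial.evalRingHom a) (reverse H) = map (Polynomial.evalRingHom b) H := by
  ext d
  simp [reverse, Polynomial.eval_comp, hab]

theorem IsTransport.reverse {ξ : Fin n → TimeSeries n} {h : MvPowerSeries (Fin n) ℂ}
    {H : TimeSeries n} (hH : IsTransport ξ h H) :
    IsTransport (fun i => -TimeSeries.reverse (ξ i)) (map (Polynomial.evalRingHom 1) H)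
      (TimeSeries.reverse H) where
  dt_eq := by rw [dt_reverse, along_reverse, hH.dt_eq]
  map_zero_eq := map_eval_reverse 0 1 (by simp) H

theorem tsum_coeff_comp_le (K : ℝ≥0) (p : Polynomial ℂ) :
    ∑' j, ‖(p.comp (1 - Polynomial.X)).coeff j‖ₑ * (K : ℝ≥0∞) ^ j ≤
      ∑' j, ‖p.coeff j‖ₑ * ((K + 1 : ℝ≥0) : ℝ≥0∞) ^ j := by
  -- Polynomials in `t` are viewed as series in no variables, so that the norm is submultiplicative
  -- and `1 - t` has norm at most `K + 1`.
  simp only [← wnorm_geom_C_le (n := 0) 1]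
  have hpow : ∀ i : ℕ, wnorm (geom 1 K) (C ((1 - Polynomial.X) ^ i) : TimeSeries 0) ≤
      ((K + 1 : ℝ≥0) : ℝ≥0∞) ^ i := by
    have h1 : wnorm (geom 1 K) (C 1 : TimeSeries 0) ≤ 1 := by
      rw [wnorm_geom_C_le, tsum_eq_single 0]
      · simp
      · intro j hj
        simp [Polynomial.coeff_one, hj]
    have h2 : wnorm (geom 1 K) (C Polynomial.X : TimeSeries 0) ≤ K := by
      rw [wnorm_geom_C_le, tsum_eq_single 1]
      · simp
      · intro j hj
        simp [Polynomial.coeff_X, hj.symm]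
    intro i
    induction i with
    | zero => simpa using h1
    | succ i ih =>
      rw [pow_succ, pow_succ, map_mul]
      refine (wnorm_geom_mul_le _ _ _ _).trans (mul_le_mul' ih ?_)
      rw [map_sub, sub_eq_add_neg, ENNReal.coe_add, add_comm]
      refine (wnorm_add_le _ _ _).trans (add_le_add ?_ h1)
      rwa [wnorm_neg]
  rw [Polynomial.comp, Polynomial.eval₂_eq_sum_range, map_sum]
  refine (wnorm_sum_le _ _ _).trans ?_
  rw [wnorm_geom_C_le]
  refine le_trans (Finset.sum_le_sum fun i _ => ?_) (ENNReal.sum_le_tsum _)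
  rw [map_mul]
  refine (wnorm_geom_mul_le _ _ _ _).trans (mul_le_mul' ?_ (hpow i))
  rw [wnorm_geom_C_le, tsum_eq_single 0]
  · simp
  · intro j hj
    simp [Polynomial.coeff_C, hj]

theorem wnorm_reverse_le (r K : ℝ≥0) (H : TimeSeries n) :
    wnorm (geom r K) (reverse H) ≤ wnorm (geom r (K + 1)) H := by
  refine ENNReal.tsum_le_tsum fun d => ?_
  have h := tsum_coeff_comp_le K (coeff d H)
  calc _ = (r : ℝ≥0∞) ^ d.degree *
        ∑' j, ‖((coeff d H).comp (1 - Polynomial.X)).coeff j‖ₑ * (K : ℝ≥0∞) ^ j := by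
        rw [← ENNReal.tsum_mul_left]
        refine tsum_congr fun j => ?_
        rw [reverse, coeff_map, Polynomial.coe_compRingHom_apply, geom]
        ring
    _ ≤ _ := mul_le_mul_right h _
    _ = _ := by
        rw [← ENNReal.tsum_mul_left]
        refine tsum_congr fun j => ?_
        rw [geom]
        ring

theorem neg_reverse_mem_convergent {K : ℝ≥0} {H : TimeSeries n} (h : H ∈ convergent n (K + 1)) :
    -reverse H ∈ convergent n K := by
  obtain ⟨r, hr, hH⟩ := h
  exact neg_mem ⟨r, hr, ne_top_of_le_ne_top hH (wnorm_reverse_le _ _ _)⟩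

theorem convergent_mono {K L : ℝ≥0} (hKL : K ≤ L) : convergent n L ≤ convergent n K := by
  rintro H ⟨r, hr, hH⟩
  exact ⟨r, hr, ne_top_of_le_ne_top hH (wnorm_mono (fun m j => by unfold geom; gcongr) H)⟩

theorem natCast_le_order_neg_reverse {k : ℕ} {H : TimeSeries n} (h : (k : ℕ∞) ≤ H.order) :
    (k : ℕ∞) ≤ (-reverse H).order := by
  rw [order_neg]
  exact h.trans (le_order_map _)

/-! ### Convergence of the transported series. -/

theorem wnorm_map_C (W : ℕ → ℕ → ℝ≥0∞) (f : MvPowerSeries (Fin n) ℂ) :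
    wnorm W (map Polynomial.C f : TimeSeries n) =
      ∑' d : Fin n →₀ ℕ, ‖coeff d f‖ₑ * W d.degree 0 := by
  refine tsum_congr fun d => ?_
  rw [tsum_eq_single 0 fun j hj => by simp [Polynomial.coeff_C, hj]]
  simp

theorem isConvergent_iff_exists_tsum_ne_top {f : MvPowerSeries (Fin n) ℂ} :
    ConvSeries.IsConvergent f ↔
      ∃ r : ℝ≥0, 0 < r ∧ ∑' d : Fin n →₀ ℕ, ‖coeff d f‖ₑ * (r : ℝ≥0∞) ^ d.degree ≠ ⊤ := by
  have key : ∀ r : ℝ≥0, (Summable fun d : Fin n →₀ ℕ => ‖coeff d f‖ * (r : ℝ) ^ d.degree) ↔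
      ∑' d : Fin n →₀ ℕ, ‖coeff d f‖ₑ * (r : ℝ≥0∞) ^ d.degree ≠ ⊤ := by
    intro r
    have h1 : (fun d : Fin n →₀ ℕ => ‖coeff d f‖ * (r : ℝ) ^ d.degree) =
        fun d => ((‖coeff d f‖₊ * r ^ d.degree : ℝ≥0) : ℝ) := by
      ext d
      simp
    have h2 : (fun d : Fin n →₀ ℕ => ‖coeff d f‖ₑ * (r : ℝ≥0∞) ^ d.degree) =
        fun d => ((‖coeff d f‖₊ * r ^ d.degree : ℝ≥0) : ℝ≥0∞) := by
      ext d
      simp [enorm_eq_nnnorm]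
    rw [h1, h2, NNReal.summable_coe, ENNReal.tsum_coe_ne_top_iff_summable]
  constructor
  · rintro ⟨r, hr, h⟩
    exact ⟨⟨r, hr.le⟩, hr, (key ⟨r, hr.le⟩).mp h⟩
  · rintro ⟨r, hr, h⟩
    exact ⟨r, hr, (key r).mpr h⟩

theorem map_C_mem_convergent (K : ℝ≥0) (f : ConvSeries n) :
    (map Polynomial.C (f : MvPowerSeries (Fin n) ℂ) : TimeSeries n) ∈ convergent n K := by
  obtain ⟨r, hr, h⟩ := isConvergent_iff_exists_tsum_ne_top.mp f.2
  refine ⟨r, hr, ?_⟩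
  rw [wnorm_map_C]
  simpa [geom] using h

theorem isConvergent_map_eval {K : ℝ≥0} {a : ℂ} (ha : ‖a‖ₑ ≤ K) {H : TimeSeries n}
    (hH : H ∈ convergent n K) : ConvSeries.IsConvergent (map (Polynomial.evalRingHom a) H) := by
  obtain ⟨r, hr, h⟩ := hH
  refine isConvergent_iff_exists_tsum_ne_top.mpr ⟨r, hr, ne_top_of_le_ne_top h ?_⟩
  refine ENNReal.tsum_le_tsum fun d => ?_
  rw [coeff_map, Polynomial.coe_evalRingHom, Polynomial.eval_eq_sum_range]
  refine le_trans ?_ (ENNReal.sum_le_tsum (Finset.range ((coeff d H).natDegree + 1)))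
  refine (mul_le_mul_left (enorm_sum_le _ _) _).trans ?_
  rw [Finset.sum_mul]
  refine Finset.sum_le_sum fun j _ => ?_
  rw [enorm_mul, enorm_pow, geom, mul_assoc, mul_comm (‖a‖ₑ ^ j)]
  gcongr

/-- Order at least two makes the norm of `ξ i` at most `C * r` with `C` arbitrarily small, which
beats the factor `K / r`. The choice `C = 1 / (2K(n+1))` leaves `n / (2(n+1)) ≤ 1/2`. -/
theorem exists_sum_wnorm_le {ξ : Fin n → TimeSeries n} (hξ : ∀ i, (2 : ℕ∞) ≤ (ξ i).order)
    {K : ℝ≥0} (hK : 0 < K) (hc : ∀ i, ξ i ∈ convergent n K) :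
    ∃ δ : ℝ≥0, 0 < δ ∧ ∀ r : ℝ≥0, 0 < r → r ≤ δ →
      ∑ i, (K / r : ℝ≥0) * wnorm (geom r K) (ξ i) ≤ 2⁻¹ := by
  have h : ∀ i, ∃ δ : ℝ≥0, 0 < δ ∧ ∀ r : ℝ≥0, r ≤ δ →
      wnorm (geom r K) (ξ i) ≤ (2 * K * (n + 1) : ℝ≥0)⁻¹ * r ^ 1 := by
    intro i
    obtain ⟨ρ, hρ, hfin⟩ := hc i
    obtain ⟨δ, hδ, hle⟩ := exists_wnorm_geom_le (C := (2 * K * (n + 1))⁻¹) hρ (by positivity) hfin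
      (hξ i)
    exact ⟨δ, hδ, hle⟩
  choose δ hδ hle using h
  obtain ⟨ε, hε, hεle⟩ : ∃ ε : ℝ≥0, 0 < ε ∧ ∀ i, ε ≤ δ i := by
    rcases isEmpty_or_nonempty (Fin n) with _ | _
    · exact ⟨1, one_pos, fun i => isEmptyElim i⟩
    · exact ⟨Finset.univ.inf' Finset.univ_nonempty δ,
        (Finset.lt_inf'_iff _).mpr fun i _ => hδ i, fun i => Finset.inf'_le _ (Finset.mem_univ i)⟩
  refine ⟨ε, hε, fun r hr hrε => ?_⟩
  calc _ ≤ ∑ _i : Fin n, ((K / r * ((2 * K * (n + 1))⁻¹ * r ^ 1) : ℝ≥0) : ℝ≥0∞) := by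
        refine Finset.sum_le_sum fun i _ => ?_
        rw [ENNReal.coe_mul]
        gcongr
        exact (hle i r (hrε.trans (hεle i))).trans_eq (by push_cast; rfl)
    _ = ((n * (K / r * ((2 * K * (n + 1))⁻¹ * r ^ 1)) : ℝ≥0) : ℝ≥0∞) := by
        rw [Finset.sum_const, Finset.card_univ, Fintype.card_fin, nsmul_eq_mul]
        push_cast
        rfl
    _ ≤ ((2⁻¹ : ℝ≥0) : ℝ≥0∞) := by
        refine ENNReal.coe_le_coe.mpr ?_
        have : (n : ℝ≥0) * (K / r * ((2 * K * (n + 1))⁻¹ * r ^ 1)) = 2⁻¹ * (n / (n + 1)) := by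
          field_simp
        rw [this]
        exact mul_le_of_le_one_right (by positivity) (div_le_one_of_le₀ (by simp) (by positivity))
    _ = 2⁻¹ := by simp

theorem IsTransport.isConvergent {ξ : Fin n → TimeSeries n} (hξ : ∀ i, (2 : ℕ∞) ≤ (ξ i).order)
    (hc : ∀ i, ξ i ∈ convergent n 2) {f : MvPowerSeries (Fin n) ℂ}
    (hf : ConvSeries.IsConvergent f) {H : TimeSeries n} (hH : IsTransport ξ f H) :
    ConvSeries.IsConvergent (map (Polynomial.evalRingHom 1) H) := by
  obtain ⟨δ, hδ, hle⟩ := exists_sum_wnorm_le hξ two_pos hc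
  obtain ⟨s, hs, hfin⟩ := isConvergent_iff_exists_tsum_ne_top.mp hf
  obtain ⟨G, hG, hn⟩ := exists_isTransport hξ f
  obtain rfl := hH.unique hξ hG
  have hr : 0 < min δ s := lt_min hδ hs
  have hb := hn (min δ s) 2 hr (hle _ hr (min_le_left _ _))
  refine isConvergent_map_eval (K := 1) (by simp) ⟨min δ s / 2, by positivity, ?_⟩
  refine ne_top_of_le_ne_top ?_ ((wnorm_mono (le_binom_two _) H).trans hb)
  refine ENNReal.mul_ne_top ENNReal.ofNat_ne_top (ne_top_of_le_ne_top hfin ?_)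
  rw [wnorm_map_C]
  refine ENNReal.tsum_le_tsum fun d => ?_
  have : binom (min δ s) 2 d.degree 0 = ((min δ s : ℝ≥0) : ℝ≥0∞) ^ d.degree := by simp [binom]
  rw [this]
  gcongr
  exact min_le_right _ _

/-! ### The automorphism given by the flow. -/

theorem IsTransport.mul {ξ : Fin n → TimeSeries n} {f g : MvPowerSeries (Fin n) ℂ}
    {H G : TimeSeries n} (hH : IsTransport ξ f H) (hG : IsTransport ξ g G) :
    IsTransport ξ (f * g) (H * G) where
  dt_eq := by rw [dt_mul, along_mul, hH.dt_eq, hG.dt_eq]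
  map_zero_eq := by rw [map_mul, hH.map_zero_eq, hG.map_zero_eq]

theorem IsTransport.add {ξ : Fin n → TimeSeries n} {f g : MvPowerSeries (Fin n) ℂ}
    {H G : TimeSeries n} (hH : IsTransport ξ f H) (hG : IsTransport ξ g G) :
    IsTransport ξ (f + g) (H + G) where
  dt_eq := by rw [map_add, map_add, hH.dt_eq, hG.dt_eq]
  map_zero_eq := by rw [map_add, hH.map_zero_eq, hG.map_zero_eq]

theorem isTransport_C (ξ : Fin n → TimeSeries n) (a : ℂ) :
    IsTransport ξ (C a) (C (Polynomial.C a)) where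
  dt_eq := by
    rw [← map_C, dt_map_C, along_apply]
    simp
  map_zero_eq := by simp

/-- The flow of a convergent vector field of order at least two, from time `0` to time `1`. -/
theorem exists_algHom_transport {ξ : Fin n → TimeSeries n} (hξ : ∀ i, (2 : ℕ∞) ≤ (ξ i).order)
    (hc : ∀ i, ξ i ∈ convergent n 2) :
    ∃ Φ : ConvSeries n →ₐ[ℂ] ConvSeries n, ∀ (f : ConvSeries n) (H : TimeSeries n),
      IsTransport ξ f H → (Φ f : MvPowerSeries (Fin n) ℂ) = map (Polynomial.evalRingHom 1) H := by
  choose H hH _ using exists_isTransport (n := n) hξ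
  have hu : ∀ {f : MvPowerSeries (Fin n) ℂ} {G : TimeSeries n}, IsTransport ξ f G → H f = G :=
    fun hG => (hH _).unique hξ hG
  have hone : H 1 = 1 := hu (by simpa using isTransport_C ξ 1)
  have hzero : H 0 = 0 := hu (by simpa using isTransport_C ξ 0)
  let Φ : ConvSeries n →ₐ[ℂ] ConvSeries n :=
    { toFun := fun f => ⟨map (Polynomial.evalRingHom 1) (H f), (hH f).isConvergent hξ hc f.2⟩
      map_one' := Subtype.ext (by simp [hone])
      map_zero' := Subtype.ext (by simp [hzero])
      map_mul' := fun f g => Subtype.ext (by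
        simp [hu ((hH (f : MvPowerSeries (Fin n) ℂ)).mul (hH (g : MvPowerSeries (Fin n) ℂ)))])
      map_add' := fun f g => Subtype.ext (by
        simp [hu ((hH (f : MvPowerSeries (Fin n) ℂ)).add (hH (g : MvPowerSeries (Fin n) ℂ)))])
      commutes' := fun a => Subtype.ext (by
        change map (Polynomial.evalRingHom 1) (H (C a)) = C a
        simp [hu (isTransport_C ξ a)]) }
  exact ⟨Φ, fun f G hG => congrArg (map (Polynomial.evalRingHom 1)) (hu hG)⟩

theorem reverse_reverse (H : TimeSeries n) : reverse (reverse H) = H := by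
  ext1 d
  simp [reverse, Polynomial.comp_assoc]

theorem exists_algEquiv_transport {ξ : Fin n → TimeSeries n} (hξ : ∀ i, (2 : ℕ∞) ≤ (ξ i).order)
    (hc : ∀ i, ξ i ∈ convergent n 3) :
    ∃ Ψ : ConvSeries n ≃ₐ[ℂ] ConvSeries n, ∀ (f : ConvSeries n) (H : TimeSeries n),
      IsTransport ξ f H → (Ψ f : MvPowerSeries (Fin n) ℂ) = map (Polynomial.evalRingHom 1) H := by
  have hξ' : ∀ i, (2 : ℕ∞) ≤ (-reverse (ξ i)).order := fun i =>
    natCast_le_order_neg_reverse (k := 2) (hξ i)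
  obtain ⟨Φ, hΦ⟩ := exists_algHom_transport hξ fun i =>
    convergent_mono (by norm_num : (2 : ℝ≥0) ≤ 3) (hc i)
  -- The substitution `t ↦ 1 - t` sends the disc of radius `2` into that of radius `3`; hence
  -- convergence with `3` is assumed.
  obtain ⟨Φ', hΦ'⟩ := exists_algHom_transport hξ' fun i =>
    neg_reverse_mem_convergent (K := 2) (by norm_num; exact hc i)
  refine ⟨AlgEquiv.ofAlgHom Φ Φ' (AlgHom.ext fun f => Subtype.ext ?_)
    (AlgHom.ext fun f => Subtype.ext ?_), hΦ⟩
  · obtain ⟨H, hH, -⟩ := exists_isTransport hξ' (f : MvPowerSeries (Fin n) ℂ)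
    -- The reversed solution is transported by the reversed field from `H(1)` back to `H(0)`, so
    -- each flow undoes the other.
    have h := hH.reverse
    simp only [map_neg, reverse_reverse, neg_neg] at h
    rw [← hΦ' f H hH] at h
    rw [AlgHom.comp_apply, hΦ _ _ h, map_eval_reverse 1 0 (by simp), hH.map_zero_eq]
    rfl
  · obtain ⟨H, hH, -⟩ := exists_isTransport hξ (f : MvPowerSeries (Fin n) ℂ)
    have h := hH.reverse
    rw [← hΦ f H hH] at h
    rw [AlgHom.comp_apply, hΦ' _ _ h, map_eval_reverse 1 0 (by simp), hH.map_zero_eq]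
    rfl

theorem IsTransport.coeff_map_one_eq {ξ : Fin n → TimeSeries n} {k : ℕ}
    (hξ : ∀ i, (k : ℕ∞) ≤ (ξ i).order) {f : MvPowerSeries (Fin n) ℂ} {H : TimeSeries n}
    (hH : IsTransport ξ f H) {d : Fin n →₀ ℕ} (hd : d.degree < k) :
    coeff d (map (Polynomial.evalRingHom 1) H) = coeff d f := by
  have h1 : (k : ℕ∞) ≤ (dt H).order := by
    rw [hH.dt_eq, along_apply]
    refine natCast_le_order_sum _ fun i _ => ?_
    exact natCast_le_order_mul (l := 0) (hξ i) (by simp)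
  have h2 := natCast_le_order_iff.mp h1 d hd
  rw [coeff_dt] at h2
  rw [← hH.map_zero_eq, coeff_map, coeff_map, Polynomial.eq_C_of_derivative_eq_zero h2]
  simp

end TimeSeries

namespace ConvSeries

open TimeSeries

variable {n : ℕ}

/-! ### Powers of the maximal ideal of `ℂ{x}`. -/

theorem isUnit_of_constantCoeff_eq_one (f : ConvSeries n)
    (h : MvPowerSeries.constantCoeff (f : MvPowerSeries (Fin n) ℂ) = 1) : IsUnit f := by
  have hu := TimeSeries.isUnit_of_constantCoeff_eq_one ⟨_, map_C_mem_convergent 1 f⟩ (by simp [h])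
  obtain ⟨g, hg⟩ := hu.exists_right_inv
  refine IsUnit.of_mul_eq_one
    ⟨_, isConvergent_map_eval (K := 1) (a := 0) (by simp) g.2⟩ (Subtype.ext ?_)
  have h1 := congrArg (fun G => MvPowerSeries.map (Polynomial.evalRingHom (0 : ℂ)) (Subtype.val G)) hg
  have h2 : (Polynomial.evalRingHom (0 : ℂ)).comp Polynomial.C = RingHom.id ℂ := by ext a; simp
  simpa [← RingHom.comp_apply, ← MvPowerSeries.map_comp, h2] using h1

/-- The ideal generated by the coordinates. -/
def coordIdeal (n : ℕ) : Ideal (ConvSeries n) := Ideal.span (Set.range X)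

/-- The ideal of convergent series of order at least `k`. -/
def orderIdeal (n k : ℕ) : Ideal (ConvSeries n) where
  carrier := {f | (k : ℕ∞) ≤ (f : MvPowerSeries (Fin n) ℂ).order}
  add_mem' := natCast_le_order_add
  zero_mem' := by simp
  smul_mem' f g hg := by
    have := natCast_le_order_mul (k := 0) (f := (f : MvPowerSeries (Fin n) ℂ)) (by simp) hg
    rwa [zero_add] at this

theorem coordIdeal_pow_le (n k : ℕ) : coordIdeal n ^ k ≤ orderIdeal n k := by
  induction k with
  | zero => exact fun f _ => by simp [orderIdeal]
  | succ k ih =>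
    rw [pow_succ, Ideal.mul_le]
    intro f hf g hg
    refine natCast_le_order_mul (ih hf) ?_
    have : coordIdeal n ≤ orderIdeal n 1 := by
      refine Ideal.span_le.mpr ?_
      rintro _ ⟨i, rfl⟩
      change ((1 : ℕ) : ℕ∞) ≤ (MvPowerSeries.X i : MvPowerSeries (Fin n) ℂ).order
      rw [natCast_le_order_iff]
      intro d hd
      obtain rfl : d = 0 := (Finsupp.degree_eq_zero_iff d).mp (by omega)
      simp
    exact this hg

theorem exists_eq_sum_X_mul (f : ConvSeries n) {k : ℕ}
    (hf : ((k + 1 : ℕ) : ℕ∞) ≤ (f : MvPowerSeries (Fin n) ℂ).order) :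
    ∃ g : Fin n → ConvSeries n, (∀ i, (k : ℕ∞) ≤ (g i : MvPowerSeries (Fin n) ℂ).order) ∧
      f = ∑ i, X i * g i := by
  classical
  rcases isEmpty_or_nonempty (Fin n) with _ | _
  · refine ⟨isEmptyElim, isEmptyElim, Subtype.ext (MvPowerSeries.ext fun d => ?_)⟩
    rw [Subsingleton.elim d 0, natCast_le_order_iff.mp hf 0 (by simp)]
    simp
  have hex : ∀ d : Fin n →₀ ℕ, d ≠ 0 → ∃ i, d i ≠ 0 := fun d hd => by
    by_contra! h
    exact hd (Finsupp.ext h)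
  -- Each nonconstant monomial is assigned to one variable dividing it; `g i` collects the monomials
  -- assigned to `i`, divided by that variable. Its coefficients are among those of `f`, so it
  -- converges.
  choose! ι hι using hex
  let g : Fin n → MvPowerSeries (Fin n) ℂ := fun i e =>
    if ι (e + Finsupp.single i 1) = i then
      MvPowerSeries.coeff (e + Finsupp.single i 1) (f : MvPowerSeries (Fin n) ℂ) else 0
  have hg : ∀ i e, MvPowerSeries.coeff e (g i) = if ι (e + Finsupp.single i 1) = i then
      MvPowerSeries.coeff (e + Finsupp.single i 1) (f : MvPowerSeries (Fin n) ℂ) else 0 :=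
    fun _ _ => rfl
  have hgc : ∀ i, IsConvergent (g i) := by
    intro i
    obtain ⟨r, hr, h⟩ := f.2
    refine ⟨r, hr, Summable.of_nonneg_of_le (fun d => by positivity) (fun e => ?_)
      ((h.comp_injective (add_left_injective (Finsupp.single i 1))).mul_left r⁻¹)⟩
    have h1 : ‖MvPowerSeries.coeff e (g i)‖ ≤
        ‖MvPowerSeries.coeff (e + Finsupp.single i 1) (f : MvPowerSeries (Fin n) ℂ)‖ := by
      rw [hg]
      split_ifs <;> simp
    simp only [Function.comp_apply]
    rw [map_add, Finsupp.degree_single, pow_succ]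
    calc _ ≤ ‖MvPowerSeries.coeff (e + Finsupp.single i 1) (f : MvPowerSeries (Fin n) ℂ)‖
          * r ^ e.degree := by gcongr
      _ = _ := by field_simp
  refine ⟨fun i => ⟨g i, hgc i⟩, fun i => ?_, Subtype.ext ?_⟩
  · rw [natCast_le_order_iff] at hf ⊢
    intro e he
    rw [hg, hf _ (by rw [map_add, Finsupp.degree_single]; omega), ite_self]
  · ext d
    have hsum : ((∑ i, X i * (⟨g i, hgc i⟩ : ConvSeries n) : ConvSeries n) :
        MvPowerSeries (Fin n) ℂ) = ∑ i, MvPowerSeries.X i * g i := by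
      rw [AddSubmonoidClass.coe_finsetSum]
      rfl
    rw [hsum, map_sum]
    have hterm : ∀ i, MvPowerSeries.coeff d (MvPowerSeries.X i * g i) =
        if d i ≠ 0 ∧ ι d = i then MvPowerSeries.coeff d (f : MvPowerSeries (Fin n) ℂ) else 0 := by
      intro i
      rw [MvPowerSeries.X, MvPowerSeries.coeff_monomial_mul, one_mul]
      by_cases hd : Finsupp.single i 1 ≤ d
      · have : d i ≠ 0 := by
          have := hd i
          simp at this
          omega
        rw [if_pos hd, hg, tsub_add_cancel_of_le hd]
        simp [this]
      · have : d i = 0 := by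
          by_contra h0
          exact hd (Finsupp.single_le_iff.mpr (Nat.one_le_iff_ne_zero.mpr h0))
        rw [if_neg hd, if_neg (by simp [this])]
    simp_rw [hterm]
    by_cases hd : d = 0
    · subst hd
      simp [natCast_le_order_iff.mp hf 0 (by simp)]
    · rw [Finset.sum_eq_single (ι d)]
      · rw [if_pos ⟨hι d hd, rfl⟩]
      · intro i _ hi
        rw [if_neg fun h => hi h.2.symm]
      · simp

theorem orderIdeal_le (n k : ℕ) : orderIdeal n k ≤ coordIdeal n ^ k := by
  induction k with
  | zero => simp
  | succ k ih =>
    intro f hf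
    obtain ⟨g, hg, rfl⟩ := exists_eq_sum_X_mul f hf
    rw [pow_succ']
    exact Ideal.sum_mem _ fun i _ =>
      Ideal.mul_mem_mul (Ideal.subset_span ⟨i, rfl⟩) (ih (hg i))

theorem mem_coordIdeal_pow_iff {f : ConvSeries n} {k : ℕ} :
    f ∈ coordIdeal n ^ k ↔ (k : ℕ∞) ≤ (f : MvPowerSeries (Fin n) ℂ).order :=
  ⟨fun h => coordIdeal_pow_le n k h, fun h => orderIdeal_le n k h⟩

theorem isUnit_add_one_of_mem {f : ConvSeries n} (hf : f ∈ coordIdeal n) : IsUnit (f + 1) := by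
  refine isUnit_of_constantCoeff_eq_one _ ?_
  rw [← pow_one (coordIdeal n), mem_coordIdeal_pow_iff] at hf
  have := natCast_le_order_iff.mp hf 0 (by simp)
  simpa using this

/-! ### The inclusion of `m^μ` in the Jacobian ideal. -/

theorem _root_.Ideal.pow_finrank_eq_bot {K A : Type*} [Field K] [CommRing A] [Algebra K A]
    [Module.Finite K A] (I : Ideal A) (hI : I ≤ Ideal.jacobson ⊥) :
    I ^ Module.finrank K A = ⊥ := by
  have : IsNoetherianRing A := isNoetherian_of_tower K inferInstance
  -- Each further power of `I` loses at least one dimension, unless two consecutive powers agree,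
  -- and then Nakayama makes them zero.
  have key : ∀ i : ℕ, Module.finrank K ((I ^ i).restrictScalars K) + i ≤ Module.finrank K A ∨
      I ^ i = ⊥ := by
    intro i
    induction i with
    | zero => exact Or.inl (Submodule.finrank_le _)
    | succ i ih =>
      rcases ih with ih | ih
      · rcases (Ideal.pow_le_pow_right i.le_succ : I ^ (i + 1) ≤ I ^ i).eq_or_lt with h | h
        · right
          rw [h]
          refine Submodule.eq_bot_of_le_smul_of_le_jacobson_bot I _ (IsNoetherian.noetherian _) ?_ hI
          rw [smul_eq_mul, ← pow_succ', h]
        · left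
          have := Submodule.finrank_lt_finrank_of_lt
            (s := (I ^ (i + 1)).restrictScalars K) (t := (I ^ i).restrictScalars K) h
          omega
      · right
        rw [pow_succ, ih, Ideal.bot_mul]
  rcases key (Module.finrank K A) with h | h
  · have h0 : Module.finrank K ((I ^ Module.finrank K A).restrictScalars K) = 0 := by omega
    rw [Submodule.finrank_eq_zero] at h0
    exact (Submodule.restrictScalars_eq_bot_iff K A A).mp h0
  · exact h

theorem coordIdeal_pow_le_jacobianIdeal {f : ConvSeries n} {μ : ℕ} (hμ : milnorNumber f = μ) :
    coordIdeal n ^ μ ≤ jacobianIdeal f := by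
  have hrank : Module.rank ℂ (MilnorAlgebra f) = (μ : Cardinal) := by
    have h := hμ
    rw [milnorNumber] at h
    exact Cardinal.toENat_eq_natCast.mp h
  have : Module.Free ℂ (MilnorAlgebra f) := Module.Free.of_divisionRing ℂ _
  have : Module.Finite ℂ (MilnorAlgebra f) := Module.finite_of_rank_eq_nat hrank
  have hfin : Module.finrank ℂ (MilnorAlgebra f) = μ := Module.finrank_eq_of_rank_eq hrank
  have h := Ideal.pow_finrank_eq_bot (K := ℂ)
    ((coordIdeal n).map (Ideal.Quotient.mk (jacobianIdeal f))) (fun x hx => by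
      obtain ⟨a, ha, rfl⟩ :=
        (Ideal.mem_map_iff_of_surjective _ Ideal.Quotient.mk_surjective).mp hx
      refine Ideal.mem_jacobson_bot.mpr fun y => ?_
      obtain ⟨b, rfl⟩ := Ideal.Quotient.mk_surjective y
      rw [← map_mul, ← map_one (Ideal.Quotient.mk (jacobianIdeal f)), ← map_add]
      exact (isUnit_add_one_of_mem (Ideal.mul_mem_right _ _ ha)).map _)
  rw [hfin, ← Ideal.map_pow, Ideal.map_eq_bot_iff_le_ker, Ideal.mk_ker] at h
  exact h

/-! ### The vector field generating the homotopy. -/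

/-- The embedding of convergent series as the time series that do not depend on time. -/
def toConvergent (n : ℕ) (K : ℝ≥0) : ConvSeries n →+* TimeSeries.convergent n K :=
  ((MvPowerSeries.map Polynomial.C).comp (ConvSeries n).val.toRingHom).codRestrict _
    (map_C_mem_convergent K)

theorem exists_sum_eq_of_mem_mul_span {R ι : Type*} [CommRing R] [Fintype ι] {I : Ideal R}
    {e : ι → R} {x : R} (h : x ∈ I * Ideal.span (Set.range e)) :
    ∃ c : ι → R, (∀ i, c i ∈ I) ∧ ∑ i, c i * e i = x := by
  obtain ⟨a, ha, hx⟩ := (Submodule.mem_ideal_smul_span_iff_exists_sum I e x).mp h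
  refine ⟨a, ha, ?_⟩
  rw [← hx, Finsupp.sum_fintype _ _ (by simp)]
  rfl

/-- The linear homotopy from `f` to `g`. -/
def homotopy (f g : ConvSeries n) : TimeSeries n :=
  MvPowerSeries.map Polynomial.C (f : MvPowerSeries (Fin n) ℂ) +
    MvPowerSeries.C Polynomial.X *
      MvPowerSeries.map Polynomial.C ((g - f : ConvSeries n) : MvPowerSeries (Fin n) ℂ)

theorem pderiv_homotopy (f g : ConvSeries n) (i : Fin n) :
    MvPowerSeries.pderiv (Polynomial ℂ) i (homotopy f g) =
      MvPowerSeries.map Polynomial.C (pderiv i f : MvPowerSeries (Fin n) ℂ) +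
        MvPowerSeries.C Polynomial.X *
          MvPowerSeries.map Polynomial.C (pderiv i (g - f) : MvPowerSeries (Fin n) ℂ) := by
  rw [homotopy, map_add, Derivation.leibniz, TimeSeries.pderiv_map, TimeSeries.pderiv_map]
  simp [pderiv]

theorem dt_homotopy (f g : ConvSeries n) : dt (homotopy f g) =
    MvPowerSeries.map Polynomial.C ((g - f : ConvSeries n) : MvPowerSeries (Fin n) ℂ) := by
  have h : dt (MvPowerSeries.C Polynomial.X : TimeSeries n) = 1 := by
    classical
    ext1 d
    rw [coeff_dt, MvPowerSeries.coeff_C, MvPowerSeries.coeff_one]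
    split_ifs <;> simp
  rw [homotopy, map_add, dt_mul, dt_map_C, dt_map_C, h]
  simp

theorem map_eval_homotopy (f g : ConvSeries n) (a : ℂ) :
    MvPowerSeries.map (Polynomial.evalRingHom a) (homotopy f g) =
      (f : MvPowerSeries (Fin n) ℂ) + MvPowerSeries.C a * ((g - f : ConvSeries n) :
        MvPowerSeries (Fin n) ℂ) := by
  have h : ∀ p : MvPowerSeries (Fin n) ℂ,
      MvPowerSeries.map (Polynomial.evalRingHom a) (MvPowerSeries.map Polynomial.C p) = p := by
    intro p
    ext d
    simp
  rw [homotopy, map_add, map_mul, h, h, MvPowerSeries.map_C, Polynomial.coe_evalRingHom,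
    Polynomial.eval_X]

/-- The linear homotopy between series which agree to high order is generated by a convergent
vector field of high order. -/
theorem exists_along_homotopy_eq {f g : ConvSeries n} {μ N : ℕ} (hN : μ + 1 ≤ N)
    (hμ : coordIdeal n ^ μ ≤ jacobianIdeal f) (hfg : g - f ∈ coordIdeal n ^ (N + 1)) (K : ℝ≥0) :
    ∃ ξ : Fin n → TimeSeries n, (∀ i, ξ i ∈ TimeSeries.convergent n K) ∧
      (∀ i, ((N + 1 - μ : ℕ) : ℕ∞) ≤ (ξ i).order) ∧
      along ξ (homotopy f g) = dt (homotopy f g) := by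
  classical
  obtain ⟨k, rfl⟩ := Nat.exists_eq_add_of_le hN
  rw [show μ + 1 + k + 1 - μ = k + 2 by omega]
  have hfgm : (coordIdeal n ^ (μ + 1 + k + 1)).FG :=
    Ideal.FG.pow ⟨Finset.univ.image X, by simp [coordIdeal]⟩
  obtain ⟨s, hs⟩ := hfgm
  have hs' : Ideal.span (Set.range (Subtype.val : s → ConvSeries n)) =
      coordIdeal n ^ (μ + 1 + k + 1) := by
    rw [← hs, Subtype.range_coe_subtype]
    rfl
  -- Each generator `e` of `m^(N+1) = m^(k+2) m^μ` is the derivative of `f` along a field `c e` with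
  -- coefficients in `m^(k+2)`.
  have hc : ∀ e : s, ∃ c : Fin n → ConvSeries n, (∀ i, c i ∈ coordIdeal n ^ (k + 2)) ∧
      ∑ i, c i * pderiv i f = e := by
    intro e
    refine exists_sum_eq_of_mem_mul_span ?_
    have h1 : (e : ConvSeries n) ∈ coordIdeal n ^ (μ + 1 + k + 1) :=
      hs ▸ Ideal.subset_span e.2
    rw [show μ + 1 + k + 1 = (k + 2) + μ by ring, pow_add] at h1
    exact Ideal.mul_mono_right hμ h1
  choose c hc hcsum using hc
  have hq : ∀ i, pderiv i (g - f) ∈ coordIdeal n ^ (μ + 1 + k) := fun i =>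
    mem_coordIdeal_pow_iff.mpr (natCast_le_order_pderiv i (mem_coordIdeal_pow_iff.mp hfg))
  -- The error from replacing `f` by the homotopy lies in `m^(k+2) m^N`, hence in `m · m^(N+1)`, so
  -- it is expressed by the generators with coefficients in `m`.
  have hD : ∀ e : s, ∃ D : s → ConvSeries n, (∀ e', D e' ∈ coordIdeal n) ∧
      ∑ e', D e' * (e' : ConvSeries n) = ∑ i, c e i * pderiv i (g - f) := by
    intro e
    refine exists_sum_eq_of_mem_mul_span ?_
    rw [hs', ← pow_succ']
    refine Ideal.sum_mem _ fun i _ => ?_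
    have h1 := Ideal.mul_mem_mul (hc e i) (hq i)
    rw [← pow_add] at h1
    exact Ideal.pow_le_pow_right (by omega) h1
  choose D hD hDsum using hD
  obtain ⟨b, -, hb⟩ : ∃ b : s → ConvSeries n, (∀ e, b e ∈ (⊤ : Ideal (ConvSeries n))) ∧
      ∑ e, b e * (e : ConvSeries n) = g - f := by
    refine exists_sum_eq_of_mem_mul_span ?_
    rw [hs', Ideal.top_mul]
    exact hfg
  let ι := toConvergent n K
  let τ : TimeSeries.convergent n K := ⟨_, C_mem_convergent K Polynomial.X⟩
  -- Row `e` of `M` expresses the derivative of the homotopy along `c e` in the generators. At `x =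
  -- 0` it is the identity for all `t`, so its determinant is a unit.
  let M : Matrix s s (TimeSeries.convergent n K) := 1 + Matrix.of fun e e' => τ * ι (D e e')
  have hM : IsUnit M.det := by
    refine TimeSeries.isUnit_of_constantCoeff_eq_one _ ?_
    let φ : TimeSeries.convergent n K →+* Polynomial ℂ :=
      MvPowerSeries.constantCoeff.comp (TimeSeries.convergent n K).subtype
    change φ M.det = 1
    have h1 : φ.mapMatrix M = 1 := by
      rw [map_add, map_one, add_eq_left]
      ext1 e e'
      have h2 := hD e e'
      rw [← pow_one (coordIdeal n), mem_coordIdeal_pow_iff, natCast_le_order_iff] at h2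
      have h3 : φ (ι (D e e')) = 0 := by
        change MvPowerSeries.constantCoeff (MvPowerSeries.map Polynomial.C
          (D e e' : MvPowerSeries (Fin n) ℂ)) = 0
        rw [← MvPowerSeries.coeff_zero_eq_constantCoeff_apply, MvPowerSeries.coeff_map,
          h2 0 (by simp), map_zero]
      simp [h3]
    rw [RingHom.map_det, h1, Matrix.det_one]
  -- The target `g - f` has coordinates `b` in the generators; solving `v M = b` gives the
  -- combination of the fields `c e` whose derivative of the homotopy is `g - f`.
  let v : s → TimeSeries.convergent n K := Matrix.vecMul (fun e => ι (b e)) M⁻¹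
  have hv : Matrix.vecMul v M = fun e => ι (b e) := by
    rw [Matrix.vecMul_vecMul, Matrix.nonsing_inv_mul _ hM, Matrix.vecMul_one]
  let ξ : Fin n → TimeSeries.convergent n K := fun i => ∑ e, v e * ι (c e i)
  have key : ∑ i, ξ i * (ι (pderiv i f) + τ * ι (pderiv i (g - f))) = ι (g - f) := by
    have hMw : Matrix.mulVec M (fun e => ι e) =
        fun e => ∑ i, ι (c e i) * (ι (pderiv i f) + τ * ι (pderiv i (g - f))) := by
      ext1 e
      have h1 : ∑ i, ι (c e i) * (ι (pderiv i f) + τ * ι (pderiv i (g - f))) =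
          ι (∑ i, c e i * pderiv i f) + τ * ι (∑ i, c e i * pderiv i (g - f)) := by
        rw [map_sum, map_sum, Finset.mul_sum, ← Finset.sum_add_distrib]
        refine Finset.sum_congr rfl fun i _ => ?_
        rw [map_mul, map_mul]
        ring
      rw [h1, hcsum, ← hDsum, map_sum, Finset.mul_sum, Matrix.add_mulVec, Matrix.one_mulVec]
      simp only [Pi.add_apply, Matrix.mulVec, dotProduct, Matrix.of_apply, map_mul, mul_assoc]
    calc _ = dotProduct v (Matrix.mulVec M fun e => ι e) := by
          rw [hMw]
          simp only [ξ, dotProduct, Finset.sum_mul, Finset.mul_sum, mul_assoc]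
          exact Finset.sum_comm
      _ = ι (g - f) := by
          rw [Matrix.dotProduct_mulVec, hv, ← hb, map_sum]
          simp [dotProduct]
  refine ⟨fun i => ξ i, fun i => (ξ i).2, fun i => ?_, ?_⟩
  · have h1 : (ξ i : TimeSeries n) = ∑ e, (v e : TimeSeries n) * (ι (c e i) : TimeSeries n) := by
      simp only [ξ, AddSubmonoidClass.coe_finsetSum]
      rfl
    change _ ≤ (ξ i : TimeSeries n).order
    rw [h1]
    refine natCast_le_order_sum _ fun e _ => ?_
    have h2 : ((k + 2 : ℕ) : ℕ∞) ≤ (ι (c e i) : TimeSeries n).order :=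
      (mem_coordIdeal_pow_iff.mp (hc e i)).trans (MvPowerSeries.le_order_map Polynomial.C)
    have := natCast_le_order_mul (k := 0) (f := (v e : TimeSeries n)) (by simp) h2
    rwa [zero_add] at this
  · rw [dt_homotopy, along_apply]
    simp only [pderiv_homotopy]
    have h := congrArg Subtype.val key
    rw [AddSubmonoidClass.coe_finsetSum] at h
    exact h

theorem isConvergent_coe (p : MvPolynomial (Fin n) ℂ) :
    IsConvergent (p : MvPowerSeries (Fin n) ℂ) :=
  ⟨1, one_pos, summable_of_ne_finset_zero (s := p.support) fun d hd => by
    rw [MvPolynomial.coeff_coe, MvPolynomial.notMem_support_iff.mp hd]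
    simp⟩

end ConvSeries

end

/-! ### Application to the truncation. -/

theorem mainTheorem9 (n : ℕ) (hn : 0 < n) (f : ConvSeries n)
    (hf : ConvSeries.IsIsolatedSingularity f)
    (μ : ℕ) (hμ : ConvSeries.milnorNumber f = (μ : ℕ∞)) (N : ℕ) (hN : μ + 1 ≤ N) :
    ∃ Ψ : ConvSeries n ≃ₐ[ℂ] ConvSeries n,
      (Ψ f : MvPowerSeries (Fin n) ℂ) =
        (ConvSeries.truncation N f : MvPowerSeries (Fin n) ℂ) ∧
      ∀ i : Fin n,
        ConvSeries.truncation (N - μ) (Ψ (ConvSeries.X i)) = MvPolynomial.X i := by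
  classical
  let g : ConvSeries n := ⟨_, ConvSeries.isConvergent_coe (ConvSeries.truncation N f)⟩
  have hg : (g : MvPowerSeries (Fin n) ℂ) = (ConvSeries.truncation N f :) := rfl
  have hfg : g - f ∈ ConvSeries.coordIdeal n ^ (N + 1) := by
    rw [ConvSeries.mem_coordIdeal_pow_iff, TimeSeries.natCast_le_order_iff]
    intro d hd
    change MvPowerSeries.coeff d ((g : MvPowerSeries (Fin n) ℂ) - (f : MvPowerSeries (Fin n) ℂ)) = 0
    rw [map_sub, hg, MvPolynomial.coeff_coe, ConvSeries.truncation,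
      MvPowerSeries.coeff_truncTotal _ hd, sub_self]
  obtain ⟨ξ, hξc, hξ, hξf⟩ := ConvSeries.exists_along_homotopy_eq hN
    (ConvSeries.coordIdeal_pow_le_jacobianIdeal hμ) hfg 3
  have hξ2 : ∀ i, (2 : ℕ∞) ≤ (ξ i).order := fun i =>
    le_trans (by exact_mod_cast (by omega : 2 ≤ N + 1 - μ)) (hξ i)
  obtain ⟨Ψ, hΨ⟩ := TimeSeries.exists_algEquiv_transport hξ2 hξc
  refine ⟨Ψ, ?_, fun i => ?_⟩
  -- The homotopy itself is the solution starting at `f`, so its value at time `1` is the image of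
  -- `f`.
  · rw [hΨ f (ConvSeries.homotopy f g)
      ⟨hξf.symm, by rw [ConvSeries.map_eval_homotopy, map_zero, zero_mul, add_zero]⟩,
      ConvSeries.map_eval_homotopy, map_one, one_mul, ← hg]
    exact add_sub_cancel _ _
  · obtain ⟨H, hH, -⟩ := TimeSeries.exists_isTransport hξ2
      (ConvSeries.X i : MvPowerSeries (Fin n) ℂ)
    ext d
    rw [ConvSeries.truncation, MvPowerSeries.coeff_truncTotal_eq_ite, hΨ _ H hH]
    split_ifs with hd
    · rw [hH.coeff_map_one_eq hξ (by omega)]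
      change MvPowerSeries.coeff d (MvPowerSeries.X i) = _
      rw [← MvPolynomial.coe_X, MvPolynomial.coeff_coe]
    -- Here `d` has degree above `N - μ`, which is at least `1`, so `d` is not the exponent of a
    -- coordinate.
    · rw [MvPolynomial.coeff_X, if_neg]
      rintro rfl
      rw [Finsupp.degree_single] at hd
      omega
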